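/- Let $k$ be a field, let $n\ge 1$, and let $\mathbf q=(q_{ij})$ be an $n\times n$ matrix over $k$ with $q_{ii}=1$ and $q_{ij}q_{ji}=1$ for all $1\le i,j\le n$. Let $$A=\mathcal O_{\mathbf q}(k^n)=k\langle x_1,\dots,x_n\rangle/(x_jx_i-q_{ij}x_ix_j,\ 1\le i,j\le n)$$ be the multiparameter quantum affine $n$-space. Write $A^e=A\otimes_k A^{\mathrm{op}}$, and identify left $A^e$-modules with $A$-$A$-bimodules. For a $k$-algebra automorphism $\nu$ of $A$, let $A^\nu$ be the bimodule with underlying space $A$ and action $a\cdot m\cdot b=am\,\nu(b)$. Call $A$ *$\nu$-twisted Calabi–Yau of dimension $d$*, with *Nakayama automorphism* $\nu$, if 1. $A$ is homologically smooth, i.e. $A$ has a resolution of finite length by finitely generated projective $A^e$-modules; and 2. $\mathrm{Ext}^i_{A^e}(A,A^e)=0$ for $i\ne d$, and $\mathrm{Ext}^d_{A^e}(A,A^e)\cong A^\nu$ as bimodules. Here $\mathrm{Ext}$ is computed with the outer (left regular) structure $a\cdot(u\otimes v)\cdot b=au\otimes vb$ on $A^e$, and carries the bimodule structure induced by the inner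 structure $a\cdot(u\otimes v)\cdot b=ub\otimes av$. Then $A$ is twisted Calabi–Yau of dimension $n$: there is exactly one $k$-algebra automorphism $\nu$ of $A$ for which $A$ is $\nu$-twisted Calabi–Yau of dimension $n$, and this Nakayama automorphism is given by $$\nu(x_i)=\Bigl(\prod_{j=1}^n q_{ji}\Bigr)x_i,\qquad 1\le i\le n.$$ -/

import Mathlib

open scoped TensorProduct

universe v u

section TwistedCalabiYau

open MulOpposite CategoryTheory

variable (k : Type v) [CommRing k] (A : Type u) [Ring A] [Algebra k A]

/-- The enveloping algebra `A ⊗ Aᵒᵖ`. Left modules over it are the `A`-`A`-bimodules on which `k`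
acts centrally: `(a ⊗ bᵒᵖ) • m` is `a · m · b`. -/
abbrev EnvelopingAlgebra : Type u := A ⊗[k] Aᵐᵒᵖ

variable {A}

/-- The bimodule `A^ν`: its underlying `k`-module is `A`, and `a · m · b = a m ν(b)`. -/
def TwistedBimodule (_ν : A ≃ₐ[k] A) : Type u := A

namespace TwistedBimodule

variable {k} (ν : A ≃ₐ[k] A)

instance : AddCommGroup (TwistedBimodule k ν) := inferInstanceAs (AddCommGroup A)

/-- The identity map `A → A^ν`. -/
def of : A ≃+ TwistedBimodule k ν := AddEquiv.refl A

/-- The representation of `A ⊗ Aᵒᵖ` on `A` in which `a ⊗ bᵒᵖ` acts by `m ↦ a m ν(b)`. -/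
noncomputable def action : EnvelopingAlgebra k A →ₐ[k] Module.End k A :=
  Algebra.TensorProduct.lift
    (Algebra.lmul k A)
    ((Algebra.lsmul k k A : Aᵐᵒᵖ →ₐ[k] Module.End k A).comp (AlgEquiv.op ν).toAlgHom)
    (fun a b => LinearMap.ext fun m => (mul_assoc a m (ν b.unop)).symm)

theorem action_tmul (a b m : A) : action ν (a ⊗ₜ op b) m = a * m * ν b :=
  (congrArg (fun f : Module.End k A => f m)
    (Algebra.TensorProduct.lift_tmul _ _ _ a (op b))).trans (mul_assoc a m (ν b)).symm

noncomputable instance : Module (EnvelopingAlgebra k A) (TwistedBimodule k ν) :=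
  Module.compHom A (action ν).toRingHom

theorem tmul_op_smul (a b m : A) :
    (a ⊗ₜ[k] op b : EnvelopingAlgebra k A) • of ν m = of ν (a * m * ν b) :=
  action_tmul ν a b m

end TwistedBimodule

variable (A)

/-- `A` itself as an `A`-`A`-bimodule, with `a · m · b = a m b`. -/
abbrev RegularBimodule : Type u := TwistedBimodule k (AlgEquiv.refl : A ≃ₐ[k] A)

/-- `A` is homologically smooth: as an `A ⊗ Aᵒᵖ`-module it has a resolution of finite length by
finitely generated projective modules. -/
def IsHomologicallySmooth : Prop :=
  ∃ P : ProjectiveResolution (ModuleCat.of (EnvelopingAlgebra k A) (RegularBimodule k A)),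
    (∀ i, Module.Finite (EnvelopingAlgebra k A) (P.complex.X i)) ∧
      ∃ N : ℕ, ∀ i, N < i → Limits.IsZero (P.complex.X i)

namespace EnvelopingAlgebra

/-- The flip `a ⊗ bᵒᵖ ↦ b ⊗ aᵒᵖ`, as an algebra isomorphism from `A ⊗ Aᵒᵖ` to its opposite. -/
noncomputable def flipOp : EnvelopingAlgebra k A ≃ₐ[k] (EnvelopingAlgebra k A)ᵐᵒᵖ :=
  ((Algebra.TensorProduct.congr (AlgEquiv.opOp k A) AlgEquiv.refl).trans
    (Algebra.TensorProduct.opAlgEquiv k k Aᵐᵒᵖ A)).trans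
      (AlgEquiv.op (Algebra.TensorProduct.comm k Aᵐᵒᵖ A))

variable {A}

theorem flipOp_tmul (a b : A) :
    flipOp k A (a ⊗ₜ op b) = op (b ⊗ₜ op a) := rfl

variable {k}

/-- The inner action of `A ⊗ Aᵒᵖ` on itself, by endomorphisms of the outer (left regular)
module: `a ⊗ bᵒᵖ` sends `m ⊗ n` to `m b ⊗ a n`, the second product being that of `A`. -/
noncomputable def innerAction (r : EnvelopingAlgebra k A) :
    ModuleCat.of (EnvelopingAlgebra k A) (EnvelopingAlgebra k A) ⟶
      ModuleCat.of (EnvelopingAlgebra k A) (EnvelopingAlgebra k A) :=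
  ModuleCat.ofHom
    (LinearMap.toSpanSingleton (EnvelopingAlgebra k A) (EnvelopingAlgebra k A)
      (flipOp k A r).unop)

theorem innerAction_apply (r s : EnvelopingAlgebra k A) :
    (innerAction r).hom s = s * (flipOp k A r).unop := rfl

theorem innerAction_tmul (a b m n : A) :
    (innerAction (a ⊗ₜ[k] op b)).hom (m ⊗ₜ[k] op n) = (m * b) ⊗ₜ[k] op (a * n) := by
  rw [innerAction_apply, flipOp_tmul, unop_op, Algebra.TensorProduct.tmul_mul_tmul, ← op_mul]

theorem innerAction_one : innerAction (1 : EnvelopingAlgebra k A) = 𝟙 _ :=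
  ModuleCat.hom_ext <| LinearMap.ext fun (s : EnvelopingAlgebra k A) =>
    show s * (flipOp k A 1).unop = s by rw [map_one, unop_one, mul_one]

theorem innerAction_zero : innerAction (0 : EnvelopingAlgebra k A) = 0 :=
  ModuleCat.hom_ext <| LinearMap.ext fun (s : EnvelopingAlgebra k A) =>
    show s * (flipOp k A 0).unop = 0 by rw [map_zero, unop_zero, mul_zero]

theorem innerAction_add (r s : EnvelopingAlgebra k A) :
    innerAction (r + s) = innerAction r + innerAction s :=
  ModuleCat.hom_ext <| LinearMap.ext fun (t : EnvelopingAlgebra k A) =>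
    show t * (flipOp k A (r + s)).unop = t * (flipOp k A r).unop + t * (flipOp k A s).unop by
      rw [map_add, MulOpposite.unop_add, mul_add]

theorem innerAction_mul (r s : EnvelopingAlgebra k A) :
    innerAction (r * s) = innerAction s ≫ innerAction r :=
  ModuleCat.hom_ext <| LinearMap.ext fun (t : EnvelopingAlgebra k A) =>
    show t * (flipOp k A (r * s)).unop = t * (flipOp k A s).unop * (flipOp k A r).unop by
      rw [map_mul, unop_mul, mul_assoc]

end EnvelopingAlgebra

/-- The group `Ext^i(A, A ⊗ Aᵒᵖ)` over `A ⊗ Aᵒᵖ`, computed with the outer structure on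
`A ⊗ Aᵒᵖ`. -/
def BimoduleExt (i : ℕ) : Type u :=
  Abelian.Ext.{u} (ModuleCat.of (EnvelopingAlgebra k A) (RegularBimodule k A))
    (ModuleCat.of (EnvelopingAlgebra k A) (EnvelopingAlgebra k A)) i

namespace BimoduleExt

open EnvelopingAlgebra

noncomputable instance (i : ℕ) : AddCommGroup (BimoduleExt k A i) :=
  inferInstanceAs (AddCommGroup (Abelian.Ext.{u}
    (ModuleCat.of (EnvelopingAlgebra k A) (RegularBimodule k A))
    (ModuleCat.of (EnvelopingAlgebra k A) (EnvelopingAlgebra k A)) i))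

variable {k A}

/-- The action of `r` on `Ext^i(A, A ⊗ Aᵒᵖ)` is induced by its inner action on the second
argument. -/
noncomputable instance (i : ℕ) : SMul (EnvelopingAlgebra k A) (BimoduleExt k A i) where
  smul r α := Abelian.Ext.comp α (Abelian.Ext.mk₀ (innerAction r)) (add_zero i)

theorem smul_def {i : ℕ} (r : EnvelopingAlgebra k A)
    (α : Abelian.Ext.{u} (ModuleCat.of (EnvelopingAlgebra k A) (RegularBimodule k A))
      (ModuleCat.of (EnvelopingAlgebra k A) (EnvelopingAlgebra k A)) i) :
    (r • (show BimoduleExt k A i from α) : BimoduleExt k A i) =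
      α.comp (Abelian.Ext.mk₀ (innerAction r)) (add_zero i) := rfl

noncomputable instance (i : ℕ) : Module (EnvelopingAlgebra k A) (BimoduleExt k A i) where
  one_smul α := (congrArg (fun f => Abelian.Ext.comp α (Abelian.Ext.mk₀ f) (add_zero i))
    innerAction_one).trans (Abelian.Ext.comp_mk₀_id α)
  mul_smul r s α := (congrArg (fun f => Abelian.Ext.comp α (Abelian.Ext.mk₀ f) (add_zero i))
    (innerAction_mul r s)).trans <|
      (congrArg (fun f => Abelian.Ext.comp α f (add_zero i))
        (Abelian.Ext.mk₀_comp_mk₀ (innerAction s) (innerAction r)).symm).trans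
      (Abelian.Ext.comp_assoc_of_third_deg_zero α _ _ (add_zero i)).symm
  smul_zero r := Abelian.Ext.zero_comp _ _ (Abelian.Ext.mk₀ (innerAction r)) i (add_zero i)
  smul_add r α β := Abelian.Ext.add_comp α β (Abelian.Ext.mk₀ (innerAction r)) (add_zero i)
  add_smul r s α := (congrArg (fun f => Abelian.Ext.comp α f (add_zero i))
    ((congrArg Abelian.Ext.mk₀ (innerAction_add r s)).trans (Abelian.Ext.mk₀_add _ _))).trans
      (Abelian.Ext.comp_add α _ _ (add_zero i))
  zero_smul α := (congrArg (fun f => Abelian.Ext.comp α f (add_zero i))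
    ((congrArg Abelian.Ext.mk₀ innerAction_zero).trans (Abelian.Ext.mk₀_zero _ _))).trans
      (Abelian.Ext.comp_zero α _ 0 i (add_zero i))

end BimoduleExt

variable {A}

/-- `A` is `ν`-twisted Calabi–Yau of dimension `d`, i.e. twisted Calabi–Yau of dimension `d` with
Nakayama automorphism `ν`. -/
structure IsTwistedCalabiYau (ν : A ≃ₐ[k] A) (d : ℕ) : Prop where
  smooth : IsHomologicallySmooth k A
  ext_eq_zero : ∀ i : ℕ, i ≠ d → Subsingleton (BimoduleExt k A i)
  ext_iso : Nonempty (BimoduleExt k A d ≃ₗ[EnvelopingAlgebra k A] TwistedBimodule k ν)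

end TwistedCalabiYau

section QuantumAffineSpace

variable {k : Type v} [CommRing k] {n : ℕ}

/-- The relations `x_j x_i = q_{ij} x_i x_j` on the free algebra on `x_1, …, x_n`. -/
inductive QuantumAffineSpace.Rel (q : Matrix (Fin n) (Fin n) k) :
    FreeAlgebra k (Fin n) → FreeAlgebra k (Fin n) → Prop
  | comm (i j : Fin n) : Rel q
      (FreeAlgebra.ι k j * FreeAlgebra.ι k i)
      (q i j • (FreeAlgebra.ι k i * FreeAlgebra.ι k j))

/-- The multiparameter quantum affine `n`-space
`k⟨x_1, …, x_n⟩ / (x_j x_i - q_{ij} x_i x_j)`. -/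
abbrev QuantumAffineSpace (q : Matrix (Fin n) (Fin n) k) : Type v :=
  RingQuot (QuantumAffineSpace.Rel q)

/-- The generator `x_i`. -/
noncomputable def QuantumAffineSpace.x (q : Matrix (Fin n) (Fin n) k) (i : Fin n) :
    QuantumAffineSpace q :=
  RingQuot.mkAlgHom k (QuantumAffineSpace.Rel q) (FreeAlgebra.ι k i)

end QuantumAffineSpace

/-! ### Quantum affine space: universal property and right division by a generator. -/

section QuantumAffineSpaceStructure

namespace QuantumAffineSpace

variable {k : Type v} [CommRing k] {n : ℕ} {q : Matrix (Fin n) (Fin n) k}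

/-! The bimodule `A` is `A^e` modulo the left ideal generated by the elements `x_i ⊗ 1 - 1 ⊗ x_i`.
These q-commute rather than commute, so the Koszul argument for polynomial rings is run with
parameters. Let `M(S, κ)` be `A^e` modulo the left ideal generated by `x_i ⊗ 1 - κ_i (1 ⊗ x_i)`, `i
∈ S`. For `j ∉ S`, right multiplication by `x_j ⊗ 1 - κ_j (1 ⊗ x_j)` gives a short exact sequence `0
→ M(S, κ') → M(S, κ) → M(S ∪ {j}, κ) → 0` with `κ'_i = q_{ji} κ_i`. Well-definedness is the
q-commutation `skewGen_mul`; injectivity is `mem_skewIdeal_of_mul_mem`, proved with a locally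
nilpotent operator that divides by `x_j` on the right.

By induction on `S`, starting from the free module `M(∅, κ)`, these sequences give finite projective
resolutions. For nonzero `κ_i` they also give the Ext groups: `Ext(M(S, κ), A^e)` is concentrated in
degree `|S|` and is cyclic for the inner structure. Its annihilator is the ideal of the same kind
with parameters `(∏_{l ∈ S} q_{il}) / κ_i` (`dualParam`). The induction needs to know how right
multiplications act on the chosen generators (`IsKoszulClass`); each new index contributes one
factor `q_{jl}` to that action. For `S` everything and `κ = 1`, the annihilator is that of `1 ∈
A^ν`, where `ν` scales `x_i` by the inverse of `∏_l q_{il}`, namely `∏_l q_{li}`.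

For uniqueness, an isomorphism `A^ν ≅ A^{ν'}` makes `ν` and `ν'` conjugate by a unit. The
`ℕ^n`-grading forces units to be scalars, hence central, so `ν = ν'`. -/

theorem x_mul_x (i j : Fin n) : x q j * x q i = q i j • (x q i * x q j) := by
  have h := RingQuot.mkAlgHom_rel k (Rel.comm (q := q) i j)
  rw [map_mul, map_smul, map_mul] at h
  exact h

/-- The universal property of the quantum affine space. -/
noncomputable def lift {B : Type*} [Ring B] [Algebra k B] (g : Fin n → B)
    (hg : ∀ i j, g j * g i = q i j • (g i * g j)) : QuantumAffineSpace q →ₐ[k] B :=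
  RingQuot.liftAlgHom k ⟨FreeAlgebra.lift k g, by
    rintro _ _ ⟨i, j⟩
    simp only [map_mul, map_smul, FreeAlgebra.lift_ι_apply, hg i j]⟩

@[simp]
theorem lift_x {B : Type*} [Ring B] [Algebra k B] (g : Fin n → B)
    (hg : ∀ i j, g j * g i = q i j • (g i * g j)) (i : Fin n) : lift g hg (x q i) = g i := by
  simp [lift, x]

theorem adjoin_range_x : Algebra.adjoin k (Set.range (x q)) = ⊤ := by
  have h : Set.range (x q) = (RingQuot.mkAlgHom k (Rel q)) '' Set.range (FreeAlgebra.ι k) := by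
    rw [← Set.range_comp]; rfl
  rw [h, ← AlgHom.map_adjoin, FreeAlgebra.adjoin_range_ι, Algebra.map_top,
    AlgHom.range_eq_top]
  exact RingQuot.mkAlgHom_surjective k _

theorem algHom_ext {B : Type*} [Ring B] [Algebra k B] {f g : QuantumAffineSpace q →ₐ[k] B}
    (h : ∀ i, f (x q i) = g (x q i)) : f = g :=
  AlgHom.ext_of_adjoin_eq_top adjoin_range_x (by rintro _ ⟨i, rfl⟩; exact h i)

/-- A subspace containing `1` and stable under right multiplication by the generators is
everything. -/
theorem induction_mul_right {P : QuantumAffineSpace q → Prop} (one : P 1)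
    (add : ∀ a b, P a → P b → P (a + b)) (smul : ∀ (c : k) a, P a → P (c • a))
    (mul_x : ∀ a i, P a → P (a * x q i)) (a : QuantumAffineSpace q) : P a := by
  -- Closure under right multiplication by `a` is multiplicative in `a`, so induction over the
  -- generated subalgebra applies to it although not to `P` itself.
  have key : ∀ b, P b → P (b * a) := by
    have ha : a ∈ Algebra.adjoin k (Set.range (x q)) := by
      rw [adjoin_range_x]; exact Algebra.mem_top
    induction ha using Algebra.adjoin_induction with
    | mem y hy => obtain ⟨i, rfl⟩ := hy; exact fun b hb => mul_x b i hb
    | algebraMap c =>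
      intro b hb
      rw [← Algebra.commutes, ← Algebra.smul_def]
      exact smul c b hb
    | add y z _ _ hy hz => intro b hb; rw [mul_add]; exact add _ _ (hy b hb) (hz b hb)
    | mul y z _ _ hy hz => intro b hb; rw [← mul_assoc]; exact hz _ (hy b hb)
  simpa using key 1 one

section RightDivision

variable (hq_diag : ∀ i, q i i = 1) (hq_inv : ∀ i j, q i j * q j i = 1) (j : Fin n)

/-- The `2 × 2` matrix representation over the algebra whose upper right entry is right
division by `x_j`. -/
noncomputable def divMatrix : QuantumAffineSpace q →ₐ[k] Matrix (Fin 2) (Fin 2)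
    (QuantumAffineSpace q) :=
  -- The matrices have the shape `(a, D a; 0, σ a)`, where `σ` kills `x_j` and scales `x_i` by
  -- `q_{ij}`. Thus `D` is the skew derivation `D(ab) = a D(b) + D(a) σ(b)` with `D(x_j) = 1` and
  -- `D(x_i) = 0` otherwise, and `σ(x_j) = 0` gives `D(a x_j) = a`.
  lift (fun i => if i = j then !![x q j, 1; 0, 0] else !![x q i, 0; 0, q i j • x q i]) (by
    intro i l
    by_cases hi : i = j <;> by_cases hl : l = j
    · subst hi hl
      simp [hq_diag]
    · subst hi
      rw [if_neg hl, if_pos rfl]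
      ext a b
      fin_cases a <;> fin_cases b <;>
        simp [Matrix.mul_apply, Fin.sum_univ_two, x_mul_x i l, smul_smul, hq_inv]
    · subst hl
      rw [if_neg hi, if_pos rfl]
      ext a b
      fin_cases a <;> fin_cases b <;>
        simp [Matrix.mul_apply, Fin.sum_univ_two, x_mul_x i l]
    · rw [if_neg hi, if_neg hl]
      ext a b
      fin_cases a <;> fin_cases b <;>
        simp [Matrix.mul_apply, Fin.sum_univ_two, x_mul_x i l, smul_smul, mul_comm, mul_left_comm])

/-- Right division by `x_j`. -/
noncomputable def rightDiv : QuantumAffineSpace q →ₗ[k] QuantumAffineSpace q where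
  toFun a := divMatrix hq_diag hq_inv j a 0 1
  map_add' a b := by simp
  map_smul' c a := by simp

theorem divMatrix_apply_zero_zero (a : QuantumAffineSpace q) :
    divMatrix hq_diag hq_inv j a 0 0 = a := by
  induction a using induction_mul_right with
  | one => simp
  | add a b ha hb => simp [ha, hb]
  | smul c a ha => simp [ha]
  | mul_x a i ha =>
    rw [map_mul, Matrix.mul_apply, Fin.sum_univ_two, ha, divMatrix, lift_x]
    split_ifs with h
    · subst h; simp
    · simp

theorem rightDiv_one : rightDiv hq_diag hq_inv j 1 = 0 := by
  simp [rightDiv]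

theorem rightDiv_mul_x_self (a : QuantumAffineSpace q) :
    rightDiv hq_diag hq_inv j (a * x q j) = a := by
  change divMatrix hq_diag hq_inv j (a * x q j) 0 1 = a
  rw [map_mul, Matrix.mul_apply, Fin.sum_univ_two, divMatrix_apply_zero_zero]
  simp [divMatrix]

theorem rightDiv_mul_x {i : Fin n} (hi : i ≠ j) (a : QuantumAffineSpace q) :
    rightDiv hq_diag hq_inv j (a * x q i) = q i j • (rightDiv hq_diag hq_inv j a * x q i) := by
  change divMatrix hq_diag hq_inv j (a * x q i) 0 1 = _
  rw [map_mul, Matrix.mul_apply, Fin.sum_univ_two, divMatrix_apply_zero_zero]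
  nth_rw 3 [divMatrix]
  nth_rw 1 [divMatrix]
  rw [lift_x, if_neg hi]
  simp [rightDiv]

/-- Division lowers the degree in `x_j`: a right factor `x_j` costs one more iteration, any other
generator passes through up to a scalar. This local nilpotence makes the division induction for
ideals terminate. -/
theorem exists_rightDiv_iterate_eq_zero (a : QuantumAffineSpace q) :
    ∃ N, (rightDiv hq_diag hq_inv j ^ N) a = 0 := by
  induction a using induction_mul_right with
  | one => exact ⟨1, by simpa using rightDiv_one hq_diag hq_inv j⟩
  | add a b ha hb =>
    obtain ⟨N, hN⟩ := ha
    obtain ⟨M, hM⟩ := hb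
    refine ⟨N + M, ?_⟩
    rw [map_add, pow_add, Module.End.mul_apply, Module.End.mul_apply, hM, map_zero, add_zero,
      ← Module.End.mul_apply, ← pow_add, add_comm, pow_add, Module.End.mul_apply, hN, map_zero]
  | smul c a ha =>
    obtain ⟨N, hN⟩ := ha
    exact ⟨N, by rw [map_smul, hN, smul_zero]⟩
  | mul_x a i ha =>
    obtain ⟨N, hN⟩ := ha
    by_cases hi : i = j
    · subst hi
      exact ⟨N + 1, by rw [pow_succ, Module.End.mul_apply, rightDiv_mul_x_self, hN]⟩
    · refine ⟨N, ?_⟩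
      have : ∀ M, (rightDiv hq_diag hq_inv j ^ M) (a * x q i) =
          q i j ^ M • ((rightDiv hq_diag hq_inv j ^ M) a * x q i) := by
        intro M
        induction M with
        | zero => simp
        | succ M ih =>
          rw [pow_succ', Module.End.mul_apply, ih, map_smul, rightDiv_mul_x _ _ _ hi, smul_smul,
            ← pow_succ, Module.End.mul_apply]
      rw [this, hN, zero_mul, smul_zero]

end RightDivision

end QuantumAffineSpace

end QuantumAffineSpaceStructure

/-! ### Left ideals of the enveloping algebra generated by q-commuting elements. -/

section EnvelopingQuantumAffineSpace

open MulOpposite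

namespace QuantumAffineSpace

variable {k : Type v} [CommRing k] {n : ℕ} (q : Matrix (Fin n) (Fin n) k)

/-- The element `x_i ⊗ 1` of the enveloping algebra. -/
noncomputable def xl (i : Fin n) : EnvelopingAlgebra k (QuantumAffineSpace q) := x q i ⊗ₜ 1

/-- The element `1 ⊗ x_i` of the enveloping algebra. -/
noncomputable def xr (i : Fin n) : EnvelopingAlgebra k (QuantumAffineSpace q) := 1 ⊗ₜ op (x q i)

theorem xl_mul_xl (i j : Fin n) : xl q j * xl q i = q i j • (xl q i * xl q j) := by
  simp only [xl, Algebra.TensorProduct.tmul_mul_tmul, x_mul_x i j, TensorProduct.smul_tmul']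

theorem xr_mul_xr (i j : Fin n) : xr q i * xr q j = q i j • (xr q j * xr q i) := by
  simp only [xr, Algebra.TensorProduct.tmul_mul_tmul, ← op_mul, x_mul_x i j, op_smul,
    TensorProduct.tmul_smul]

theorem xr_mul_xl (i j : Fin n) : xr q i * xl q j = xl q j * xr q i := by
  simp only [xl, xr, Algebra.TensorProduct.tmul_mul_tmul, one_mul, mul_one]

/-- The left ideal generated by the elements `x_i ⊗ 1 - κ_i (1 ⊗ x_i)` with `i ∈ S`. -/
noncomputable def skewIdeal (S : Finset (Fin n)) (κ : Fin n → k) :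
    Submodule (EnvelopingAlgebra k (QuantumAffineSpace q))
      (EnvelopingAlgebra k (QuantumAffineSpace q)) :=
  Submodule.span _ ((fun i => xl q i - κ i • xr q i) '' S)

variable {q}

theorem skewIdeal_mono {S T : Finset (Fin n)} (h : S ⊆ T) (κ : Fin n → k) :
    skewIdeal q S κ ≤ skewIdeal q T κ :=
  Submodule.span_mono (Set.image_mono (by exact_mod_cast h))

theorem gen_mem_skewIdeal {S : Finset (Fin n)} (κ : Fin n → k) {i : Fin n} (hi : i ∈ S) :
    xl q i - κ i • xr q i ∈ skewIdeal q S κ :=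
  Submodule.subset_span ⟨i, by exact_mod_cast hi, rfl⟩

theorem skewIdeal_congr {S : Finset (Fin n)} {κ κ' : Fin n → k} (h : ∀ i ∈ S, κ i = κ' i) :
    skewIdeal q S κ = skewIdeal q S κ' := by
  refine congrArg (Submodule.span _) (Set.image_congr fun i hi => ?_)
  rw [h i (by exact_mod_cast hi)]

theorem mem_skewIdeal_insert {S : Finset (Fin n)} {κ : Fin n → k} {j : Fin n}
    {r : EnvelopingAlgebra k (QuantumAffineSpace q)} :
    r ∈ skewIdeal q (insert j S) κ ↔
      ∃ s, r - s * (xl q j - κ j • xr q j) ∈ skewIdeal q S κ := by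
  rw [skewIdeal, Finset.coe_insert, Set.image_insert_eq, Submodule.mem_span_insert]
  constructor
  · rintro ⟨a, z, hz, rfl⟩
    exact ⟨a, by rwa [smul_eq_mul, add_sub_cancel_left]⟩
  · rintro ⟨s, hs⟩
    exact ⟨s, _, hs, by rw [smul_eq_mul, add_sub_cancel]⟩

/-- Left factors satisfy `x_i x_j = q_{ji} x_j x_i`, right factors the opposite relation, and the
two kinds commute. Exchanging the linear forms therefore rescales one coefficient of each by
`q_{ji}`. -/
theorem skewGen_mul (hq_inv : ∀ i j, q i j * q j i = 1) (κ : Fin n → k) (i j : Fin n) (s t : k) :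
    (xl q i - (q j i * κ i) • xr q i) * (s • xl q j - t • xr q j) =
      ((s * q j i) • xl q j - t • xr q j) * (xl q i - κ i • xr q i) := by
  have h : q j i * q i j = 1 := hq_inv j i
  simp only [sub_mul, mul_sub, smul_mul_assoc, mul_smul_comm, xr_mul_xl, xl_mul_xl q j i,
    xr_mul_xr q i j, smul_smul]
  rw [mul_right_comm, h, one_mul, smul_sub, smul_sub, smul_sub, smul_smul, smul_smul, smul_smul,
    smul_smul, smul_smul, mul_comm t, mul_left_comm s, ← mul_assoc, mul_comm (κ i) (s * q j i),
    mul_comm (q j i) s]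
  exact sub_sub_sub_comm _ _ _ _

/-- This makes right multiplication by a form in the index `j` descend to `M(S, κ') → M(S, κ)`; the
change of parameters comes from `skewGen_mul`. -/
theorem mul_mem_skewIdeal (hq_inv : ∀ i j, q i j * q j i = 1) {S : Finset (Fin n)}
    {κ κ' : Fin n → k} {j : Fin n} (h : ∀ i ∈ S, κ' i = q j i * κ i) (s t : k)
    {r : EnvelopingAlgebra k (QuantumAffineSpace q)} (hr : r ∈ skewIdeal q S κ') :
    r * (s • xl q j - t • xr q j) ∈ skewIdeal q S κ := by
  induction hr using Submodule.span_induction with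
  | mem y hy =>
    obtain ⟨i, hi, rfl⟩ := hy
    have hi : i ∈ S := by exact_mod_cast hi
    dsimp only
    rw [h i hi, skewGen_mul hq_inv]
    exact Submodule.smul_mem _ _ (gen_mem_skewIdeal κ hi)
  | zero => rw [zero_mul]; exact zero_mem _
  | add y z _ _ hy hz => rw [add_mul]; exact add_mem hy hz
  | smul a y _ hy => rw [smul_eq_mul, mul_assoc]; exact Submodule.smul_mem _ _ hy

section Division

variable (hq_diag : ∀ i, q i i = 1) (hq_inv : ∀ i j, q i j * q j i = 1) (j : Fin n)

/-- Right division by `x_j ⊗ 1` in the enveloping algebra. -/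
noncomputable def envDiv : Module.End k (EnvelopingAlgebra k (QuantumAffineSpace q)) :=
  LinearMap.rTensor _ (rightDiv hq_diag hq_inv j)

theorem envDiv_tmul (a : QuantumAffineSpace q) (b : (QuantumAffineSpace q)ᵐᵒᵖ) :
    envDiv hq_diag hq_inv j (a ⊗ₜ b) = rightDiv hq_diag hq_inv j a ⊗ₜ b := rfl

theorem envDiv_mul_xl_self (r : EnvelopingAlgebra k (QuantumAffineSpace q)) :
    envDiv hq_diag hq_inv j (r * xl q j) = r := by
  induction r using TensorProduct.induction_on with
  | zero => simp
  | tmul a b =>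
    rw [xl, Algebra.TensorProduct.tmul_mul_tmul, envDiv_tmul, rightDiv_mul_x_self, mul_one]
  | add r s hr hs => rw [add_mul, map_add, hr, hs]

theorem envDiv_mul_xl {i : Fin n} (hi : i ≠ j)
    (r : EnvelopingAlgebra k (QuantumAffineSpace q)) :
    envDiv hq_diag hq_inv j (r * xl q i) = q i j • (envDiv hq_diag hq_inv j r * xl q i) := by
  induction r using TensorProduct.induction_on with
  | zero => simp
  | tmul a b =>
    rw [xl, Algebra.TensorProduct.tmul_mul_tmul, envDiv_tmul, rightDiv_mul_x _ _ _ hi,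
      envDiv_tmul, Algebra.TensorProduct.tmul_mul_tmul, TensorProduct.smul_tmul']
  | add r s hr hs => rw [add_mul, map_add, hr, hs, map_add, add_mul, smul_add]

theorem envDiv_mul_xr (i : Fin n) (r : EnvelopingAlgebra k (QuantumAffineSpace q)) :
    envDiv hq_diag hq_inv j (r * xr q i) = envDiv hq_diag hq_inv j r * xr q i := by
  induction r using TensorProduct.induction_on with
  | zero => simp
  | tmul a b =>
    rw [xr, Algebra.TensorProduct.tmul_mul_tmul, envDiv_tmul, envDiv_tmul,
      Algebra.TensorProduct.tmul_mul_tmul, mul_one, mul_one]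
  | add r s hr hs => rw [add_mul, map_add, hr, hs, map_add, add_mul]

theorem exists_envDiv_iterate_eq_zero (r : EnvelopingAlgebra k (QuantumAffineSpace q)) :
    ∃ N, (envDiv hq_diag hq_inv j ^ N) r = 0 := by
  induction r using TensorProduct.induction_on with
  | zero => exact ⟨0, map_zero _⟩
  | tmul a b =>
    obtain ⟨N, hN⟩ := exists_rightDiv_iterate_eq_zero hq_diag hq_inv j a
    refine ⟨N, ?_⟩
    have h := LinearMap.congr_fun (LinearMap.rTensor_pow (N := (QuantumAffineSpace q)ᵐᵒᵖ)
      (rightDiv hq_diag hq_inv j) N) (a ⊗ₜ b)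
    rw [LinearMap.rTensor_tmul, hN, TensorProduct.zero_tmul] at h
    exact h
  | add r s hr hs =>
    obtain ⟨N, hN⟩ := hr
    obtain ⟨M, hM⟩ := hs
    refine ⟨N + M, ?_⟩
    rw [map_add, pow_add, Module.End.mul_apply, Module.End.mul_apply, hM, map_zero, add_zero,
      ← Module.End.mul_apply, ← pow_add, add_comm, pow_add, Module.End.mul_apply, hN, map_zero]

theorem envDiv_mem_skewIdeal {S : Finset (Fin n)} (hj : j ∉ S) (κ : Fin n → k)
    {r : EnvelopingAlgebra k (QuantumAffineSpace q)} (hr : r ∈ skewIdeal q S κ) :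
    envDiv hq_diag hq_inv j r ∈ skewIdeal q S (fun i => q j i * κ i) := by
  -- Division is not left `A^e`-linear, so the induction over the span must carry an arbitrary left
  -- factor.
  suffices ∀ a, envDiv hq_diag hq_inv j (a * r) ∈ skewIdeal q S (fun i => q j i * κ i) by
    simpa using this 1
  induction hr using Submodule.span_induction with
  | mem y hy =>
    intro a
    obtain ⟨i, hi, rfl⟩ := hy
    have hi : i ∈ S := by exact_mod_cast hi
    have hij : i ≠ j := fun h => hj (h ▸ hi)
    have : envDiv hq_diag hq_inv j (a * (xl q i - κ i • xr q i)) =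
        (q i j • envDiv hq_diag hq_inv j a) * (xl q i - (q j i * κ i) • xr q i) := by
      rw [mul_sub, map_sub, envDiv_mul_xl _ _ _ hij, mul_smul_comm, map_smul, envDiv_mul_xr,
        mul_sub, smul_mul_assoc, smul_mul_smul_comm, ← mul_assoc, hq_inv, one_mul]
    rw [this]
    exact Submodule.smul_mem _ _ (gen_mem_skewIdeal (fun i => q j i * κ i) hi)
  | zero => intro a; rw [mul_zero, map_zero]; exact zero_mem _
  | add y z _ _ hy hz => intro a; rw [mul_add, map_add]; exact add_mem (hy a) (hz a)
  | smul b y _ hy => intro a; rw [smul_eq_mul, ← mul_assoc]; exact hy _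

/-- Dividing the hypothesis by `x_j` gives `r ≡ μ D(r) (1 ⊗ x_j)` modulo the rescaled ideal, where
`D` is `envDiv`. Local nilpotence of `D` turns this congruence into membership of `r`. This is the
regularity that yields exactness of the Koszul-type sequences. -/
theorem mem_skewIdeal_of_mul_mem (hq_diag : ∀ i, q i i = 1)
    (hq_inv : ∀ i j, q i j * q j i = 1) {j : Fin n} {S : Finset (Fin n)} (hj : j ∉ S) (κ : Fin n → k) (μ : k)
    {r : EnvelopingAlgebra k (QuantumAffineSpace q)}
    (hr : r * (xl q j - μ • xr q j) ∈ skewIdeal q S κ) :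
    r ∈ skewIdeal q S (fun i => q j i * κ i) := by
  -- Every division rescales the parameters, so `κ` varies in the induction. Applying `D` to the
  -- congruence gives the same congruence for `D r`; once `D r` lies in the rescaled ideal, right
  -- multiplication by `μ (1 ⊗ x_j)` returns to the ideal for `κ`.
  have key : ∀ N, ∀ (κ : Fin n → k) (r : EnvelopingAlgebra k (QuantumAffineSpace q)),
      (envDiv hq_diag hq_inv j ^ N) r = 0 →
      r - μ • (envDiv hq_diag hq_inv j r * xr q j) ∈ skewIdeal q S κ → r ∈ skewIdeal q S κ := by
    intro N
    induction N with
    | zero => intro κ r h0 _; rw [show r = 0 from h0]; exact zero_mem _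
    | succ N ih =>
      intro κ r h0 hr
      have h1 := envDiv_mem_skewIdeal hq_diag hq_inv j hj κ hr
      rw [map_sub, map_smul, envDiv_mul_xr] at h1
      have h2 := ih _ _ (by rw [← Module.End.mul_apply, ← pow_succ, h0]) h1
      have h3 := mul_mem_skewIdeal hq_inv (κ := κ) (j := j) (fun i _ => rfl) 0 (-μ) h2
      have hμ : (0 : k) • xl q j - (-μ) • xr q j = μ • xr q j := by
        rw [sub_eq_iff_eq_add, ← add_smul, add_neg_cancel, zero_smul, zero_smul]
      rw [hμ, mul_smul_comm] at h3
      simpa using add_mem hr h3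
  obtain ⟨N, hN⟩ := exists_envDiv_iterate_eq_zero hq_diag hq_inv j r
  refine key N _ r hN ?_
  have h := envDiv_mem_skewIdeal hq_diag hq_inv j hj κ hr
  rwa [mul_sub, map_sub, envDiv_mul_xl_self, mul_smul_comm, map_smul, envDiv_mul_xr] at h

end Division

/-- The twisted bimodule `A^ν`, for `ν` diagonal, is cyclic with the expected relations. -/
theorem smul_of_one_eq_zero_iff (ν : QuantumAffineSpace q ≃ₐ[k] QuantumAffineSpace q)
    (c κ : Fin n → k) (hν : ∀ i, ν (x q i) = c i • x q i) (hc : ∀ i, κ i * c i = 1)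
    (r : EnvelopingAlgebra k (QuantumAffineSpace q)) :
    r • TwistedBimodule.of ν 1 = 0 ↔ r ∈ skewIdeal q Finset.univ κ := by
  have hgen : ∀ i (a : QuantumAffineSpace q),
      (a ⊗ₜ op (x q i) - (a * ν (x q i)) ⊗ₜ 1 : EnvelopingAlgebra k (QuantumAffineSpace q)) ∈
        skewIdeal q Finset.univ κ := by
    intro i a
    have := Submodule.smul_mem _ (c i • (a ⊗ₜ 1 : EnvelopingAlgebra k (QuantumAffineSpace q)))
      (gen_mem_skewIdeal (q := q) κ (Finset.mem_univ i))
    rw [sub_mem_comm_iff]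
    convert this using 1
    rw [smul_eq_mul, mul_sub, smul_mul_smul_comm, mul_comm (c i), hc, one_smul, xl, xr,
      smul_mul_assoc, Algebra.TensorProduct.tmul_mul_tmul, Algebra.TensorProduct.tmul_mul_tmul,
      hν, mul_smul_comm, TensorProduct.smul_tmul', one_mul, mul_one, one_mul]
  -- Modulo the ideal every tensor can be moved to its left factor, so each class has a
  -- representative `a ⊗ 1`. Such an element sends `1` to `a`, so it annihilates `1` only if `a =
  -- 0`.
  have hdiv : ∀ b a : QuantumAffineSpace q,
      (a ⊗ₜ op b - (a * ν b) ⊗ₜ 1 : EnvelopingAlgebra k (QuantumAffineSpace q)) ∈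
        skewIdeal q Finset.univ κ := by
    intro b
    induction b using induction_mul_right with
    | one => intro a; simp
    | add b b' hb hb' =>
      intro a
      convert add_mem (hb a) (hb' a) using 1
      rw [op_add, TensorProduct.tmul_add, map_add, mul_add, TensorProduct.add_tmul]
      abel
    | smul s b hb =>
      intro a
      convert Submodule.smul_mem _ (algebraMap k _ s) (hb a) using 1
      rw [smul_eq_mul, ← Algebra.smul_def, op_smul, TensorProduct.tmul_smul, map_smul,
        mul_smul_comm, smul_sub, TensorProduct.smul_tmul', TensorProduct.smul_tmul']
    | mul_x b i hb =>
      intro a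
      convert add_mem (Submodule.smul_mem _ (xr q i) (hb a)) (hgen i (a * ν b)) using 1
      rw [smul_eq_mul, mul_sub, xr, Algebra.TensorProduct.tmul_mul_tmul,
        Algebra.TensorProduct.tmul_mul_tmul, one_mul, one_mul, mul_one, op_mul, map_mul, mul_assoc]
      abel
  constructor
  · intro h
    have hr : ∀ r : EnvelopingAlgebra k (QuantumAffineSpace q), ∃ a : QuantumAffineSpace q,
        r • TwistedBimodule.of ν 1 = TwistedBimodule.of ν a ∧
          r - a ⊗ₜ 1 ∈ skewIdeal q Finset.univ κ := by
      intro r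
      induction r using TensorProduct.induction_on with
      | zero =>
        exact ⟨0, Module.zero_smul _, by simp⟩
      | tmul a b =>
        refine ⟨a * ν b.unop, ?_, hdiv b.unop a⟩
        simpa using TwistedBimodule.tmul_op_smul ν a b.unop 1
      | add r s hr hs =>
        obtain ⟨a, ha, ha'⟩ := hr
        obtain ⟨b, hb, hb'⟩ := hs
        refine ⟨a + b, by rw [add_smul, ha, hb, map_add], ?_⟩
        rw [TensorProduct.add_tmul, add_sub_add_comm]
        exact add_mem ha' hb'
    obtain ⟨a, ha, ha'⟩ := hr r
    have h0 : a = 0 := (TwistedBimodule.of ν).injective (by rw [← ha, h, map_zero])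
    simpa [h0] using ha'
  · intro h
    induction h using Submodule.span_induction with
    | mem y hy =>
      obtain ⟨i, -, rfl⟩ := hy
      have h1 := TwistedBimodule.tmul_op_smul ν (x q i) 1 1
      have h2 := TwistedBimodule.tmul_op_smul ν (algebraMap k _ (κ i)) (x q i) 1
      have h3 : κ i • xr q i = algebraMap k (QuantumAffineSpace q) (κ i) ⊗ₜ op (x q i) := by
        rw [xr, TensorProduct.smul_tmul', Algebra.algebraMap_eq_smul_one]
      dsimp only
      rw [h3, sub_smul, h2, xl, ← op_one, h1, hν, ← map_sub, mul_smul_comm, ← smul_mul_assoc,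
        mul_one, mul_one, map_one, mul_one, smul_mul_assoc, ← Algebra.smul_def, smul_smul,
        mul_comm, hc, one_smul, sub_self, map_zero]
    | zero => exact Module.zero_smul _
    | add y z _ _ hy hz => rw [add_smul, hy, hz, add_zero]
    | smul a y _ hy => rw [smul_eq_mul, mul_smul, hy, smul_zero]

theorem exists_smul_of_one (ν : QuantumAffineSpace q ≃ₐ[k] QuantumAffineSpace q)
    (m : TwistedBimodule k ν) :
    ∃ r : EnvelopingAlgebra k (QuantumAffineSpace q), r • TwistedBimodule.of ν 1 = m :=
  ⟨(TwistedBimodule.of ν).symm m ⊗ₜ op 1, by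
    rw [TwistedBimodule.tmul_op_smul, map_one, mul_one, mul_one, AddEquiv.apply_symm_apply]⟩

end QuantumAffineSpace

end EnvelopingQuantumAffineSpace

/-! ### Finite projective resolutions: horseshoe lemma, cokernels and splicing. -/

section FiniteProjectiveResolutions

open CategoryTheory

variable (R : Type u) [Ring R]

/-- `M` has a resolution by finitely generated projective modules, zero from degree `d` on. -/
def HasFiniteProjectiveResolution :
    ℕ → ∀ (M : Type u) [AddCommGroup M] [Module R M], Prop
  | 0, M, _, _ => Subsingleton M
  | d + 1, M, _, _ => ∃ (P : Type u) (_ : AddCommGroup P) (_ : Module R P) (f : P →ₗ[R] M),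
      Module.Projective R P ∧ Module.Finite R P ∧ Function.Surjective f ∧
        HasFiniteProjectiveResolution d (LinearMap.ker f)

namespace HasFiniteProjectiveResolution

variable {R}

theorem of_equiv {d : ℕ} {M N : Type u} [AddCommGroup M] [Module R M] [AddCommGroup N]
    [Module R N] (e : M ≃ₗ[R] N) (h : HasFiniteProjectiveResolution R d M) :
    HasFiniteProjectiveResolution R d N := by
  cases d with
  | zero =>
    have : Subsingleton M := h
    exact e.symm.injective.subsingleton
  | succ d =>
    obtain ⟨P, _, _, f, hP, hfin, hf, hker⟩ := h
    refine ⟨P, _, _, e.toLinearMap ∘ₗ f, hP, hfin, e.surjective.comp hf, ?_⟩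
    rwa [LinearEquiv.ker_comp]

theorem of_projective (M : Type u) [AddCommGroup M] [Module R M] [Module.Projective R M]
    [Module.Finite R M] : HasFiniteProjectiveResolution R 1 M :=
  ⟨M, _, _, LinearMap.id, inferInstance, inferInstance, Function.surjective_id, by
    change Subsingleton _
    rw [LinearMap.ker_id]
    infer_instance⟩

theorem succ {d : ℕ} : ∀ {M : Type u} [AddCommGroup M] [Module R M],
    HasFiniteProjectiveResolution R d M → HasFiniteProjectiveResolution R (d + 1) M := by
  induction d with
  | zero =>
    intro M _ _ h
    have : Subsingleton M := h
    exact of_projective M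
  | succ d ih =>
    rintro M _ _ ⟨P, _, _, f, hP, hfin, hf, hker⟩
    exact ⟨P, _, _, f, hP, hfin, hf, ih hker⟩

/-- The horseshoe lemma. -/
theorem of_extension {d : ℕ} : ∀ {A B C : Type u} [AddCommGroup A] [Module R A]
    [AddCommGroup B] [Module R B] [AddCommGroup C] [Module R C] (i : A →ₗ[R] B) (p : B →ₗ[R] C),
    Function.Injective i → Function.Surjective p → Function.Exact i p →
    HasFiniteProjectiveResolution R d A → HasFiniteProjectiveResolution R d C →
    HasFiniteProjectiveResolution R d B := by
  induction d with
  | zero =>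
    intro A B C _ _ _ _ _ _ i p hi hp hip hA hC
    have : Subsingleton A := hA
    have : Subsingleton C := hC
    refine ⟨fun x y => ?_⟩
    obtain ⟨a, ha⟩ := (hip (x - y)).1 (Subsingleton.elim _ _)
    rw [← sub_eq_zero, ← ha, Subsingleton.elim a 0, map_zero]
  | succ d ih =>
    rintro A B C _ _ _ _ _ _ i p hi hp hip ⟨P, _, _, f, hP, hPf, hf, hfk⟩
      ⟨Q, _, _, g, hQ, hQf, hg, hgk⟩
    obtain ⟨g', hg'⟩ := Module.projective_lifting_property p g hp
    have hg'' : ∀ y, p (g' y) = g y := fun y => LinearMap.congr_fun hg' y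
    have hpi : ∀ a, p (i a) = 0 := fun a => (hip _).2 ⟨a, rfl⟩
    let h : P × Q →ₗ[R] B := (i ∘ₗ f).coprod g'
    have hh : ∀ x y, h (x, y) = i (f x) + g' y := fun x y => rfl
    refine ⟨P × Q, inferInstance, inferInstance, h, inferInstance, inferInstance, ?_, ?_⟩
    · intro b
      obtain ⟨y, hy⟩ := hg (p b)
      obtain ⟨a, ha⟩ := (hip (b - g' y)).1 (by rw [map_sub, hg'', hy, sub_self])
      obtain ⟨x, rfl⟩ := hf a
      exact ⟨(x, y), by rw [hh, ha, sub_add_cancel]⟩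
    · let i' : LinearMap.ker f →ₗ[R] LinearMap.ker h :=
        (LinearMap.inl R P Q).restrict (fun x hx => by
          rw [LinearMap.mem_ker] at hx ⊢
          rw [LinearMap.inl_apply, hh, hx, map_zero, map_zero, add_zero])
      let p' : LinearMap.ker h →ₗ[R] LinearMap.ker g :=
        (LinearMap.snd R P Q).restrict (fun x hx => by
          rw [LinearMap.mem_ker] at hx ⊢
          have := congrArg p hx
          rwa [hh x.1 x.2, map_add, hpi, zero_add, map_zero, hg''] at this)
      refine ih i' p' ?_ ?_ ?_ hfk hgk
      · intro x y hxy
        exact Subtype.ext (congrArg (fun z => z.1.1) hxy)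
      · rintro ⟨y, hy⟩
        obtain ⟨a, ha⟩ := (hip (g' y)).1 (by rw [hg'', hy])
        obtain ⟨x, hx⟩ := hf (-a)
        refine ⟨⟨(x, y), ?_⟩, rfl⟩
        rw [LinearMap.mem_ker, hh, ← ha, hx, map_neg, neg_add_cancel]
      · rintro ⟨⟨x, y⟩, hxy⟩
        constructor
        · intro h0
          have hy : y = 0 := congrArg Subtype.val h0
          subst hy
          refine ⟨⟨x, ?_⟩, rfl⟩
          rw [LinearMap.mem_ker, hh, map_zero, add_zero] at hxy
          exact hi (by rw [hxy, map_zero])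
        · rintro ⟨z, hz⟩
          refine Subtype.ext ?_
          exact (congrArg (fun w => w.1.2) hz).symm

/-- If `f : P → B` starts a resolution of `B`, then the kernel of `P → B → C` is an extension of
`ker p ≅ A` by `ker f`, and the horseshoe lemma resolves it. -/
theorem of_cokernel {d : ℕ} {A B C : Type u} [AddCommGroup A] [Module R A]
    [AddCommGroup B] [Module R B] [AddCommGroup C] [Module R C] (i : A →ₗ[R] B) (p : B →ₗ[R] C)
    (hi : Function.Injective i) (hp : Function.Surjective p) (hip : Function.Exact i p)
    (hA : HasFiniteProjectiveResolution R d A) (hB : HasFiniteProjectiveResolution R (d + 1) B) :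
    HasFiniteProjectiveResolution R (d + 1) C := by
  obtain ⟨P, _, _, f, hP, hPf, hf, hfk⟩ := hB
  refine ⟨P, _, _, p ∘ₗ f, hP, hPf, hp.comp hf, ?_⟩
  have hpi : ∀ a, p (i a) = 0 := fun a => (hip _).2 ⟨a, rfl⟩
  let e : A ≃ₗ[R] LinearMap.ker p := (LinearEquiv.ofInjective i hi).trans
    (LinearEquiv.ofEq _ _ (LinearMap.exact_iff.1 hip).symm)
  let i' : LinearMap.ker f →ₗ[R] LinearMap.ker (p ∘ₗ f) :=
    Submodule.inclusion (LinearMap.ker_le_ker_comp f p)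
  let p' : LinearMap.ker (p ∘ₗ f) →ₗ[R] LinearMap.ker p := f.restrict (fun x hx => hx)
  refine of_extension i' p' (Submodule.inclusion_injective _) ?_ ?_ hfk (hA.of_equiv e)
  · rintro ⟨b, hb⟩
    obtain ⟨x, rfl⟩ := hf b
    exact ⟨⟨x, hb⟩, rfl⟩
  · rintro ⟨x, hx⟩
    constructor
    · intro h0
      exact ⟨⟨x, congrArg Subtype.val h0⟩, rfl⟩
    · rintro ⟨z, hz⟩
      have hz' : z.1 = x := congrArg Subtype.val hz
      refine Subtype.ext ?_
      change f x = 0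
      rw [← hz', z.2]

end HasFiniteProjectiveResolution

section Splice

namespace CategoryTheory.ProjectiveResolution

variable {C : Type*} [Category C] [Abelian C]

/-- A projective resolution from an exact augmented complex of projective objects. -/
noncomputable def ofExact (K : ChainComplex C ℕ) (hK : ∀ i, Projective (K.X i)) {Z : C}
    (ε : K.X 0 ⟶ Z) (w : K.d 1 0 ≫ ε = 0) (hε : Epi ε) (h₀ : (ShortComplex.mk _ _ w).Exact)
    (h : ∀ i, K.ExactAt (i + 1)) : ProjectiveResolution Z where
  complex := K
  projective := hK
  π := (ChainComplex.toSingle₀Equiv _ _).symm ⟨ε, w⟩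
  quasiIso := ⟨fun i => by
    cases i
    · rw [ChainComplex.quasiIsoAt₀_iff, ShortComplex.quasiIso_iff_of_zeros']
      · refine (ShortComplex.exact_and_epi_g_iff_of_iso ?_).2 ⟨h₀, hε⟩
        exact ShortComplex.isoMk (Iso.refl _) (Iso.refl _) (Iso.refl _)
          ((Category.id_comp _).trans (Category.comp_id _).symm)
          ((Category.id_comp _).trans ((Category.comp_id _).trans
            (ChainComplex.toSingle₀Equiv_symm_apply_f_zero ε w)).symm)
      all_goals first | rfl | exact HomologicalComplex.shape _ _ _ (by simp)
    · rw [quasiIsoAt_iff_exactAt']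
      · exact h _
      · apply ChainComplex.exactAt_succ_single_obj⟩

/-- Splicing a projective resolution of the kernel onto an epimorphism from a projective
object. -/
noncomputable def splice {S : ShortComplex C} (hS : S.ShortExact) (hP : Projective S.X₂)
    (Q : ProjectiveResolution S.X₁) : ProjectiveResolution S.X₃ :=
  let ε : Q.complex.X 0 ⟶ S.X₁ := Q.π.f 0
  have hε : Q.complex.d 1 0 ≫ ε = 0 := Q.complex_d_comp_π_f_zero
  have hexact : (ShortComplex.mk _ _ hε).Exact := Q.exact₀
  have : Epi ε := inferInstanceAs (Epi (Q.π.f 0))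
  have w : Q.complex.d 1 0 ≫ ε ≫ S.f = 0 := by
    rw [← Category.assoc, hε, Limits.zero_comp]
  ofExact (ChainComplex.augment Q.complex (ε ≫ S.f) w)
    (fun i => match i with
      | 0 => hP
      | i + 1 => Q.projective i)
    S.g
    (show (ε ≫ S.f) ≫ S.g = 0 by rw [Category.assoc, S.zero, Limits.comp_zero])
    hS.epi_g
    (by
      -- At the splice, exactness is unaffected by precomposing with the epimorphism `ε`. In the
      -- next degree it is unaffected by postcomposing with the monomorphism `S.f`.
      let φ : ShortComplex.mk (ε ≫ S.f) S.g
          (by rw [Category.assoc, S.zero, Limits.comp_zero]) ⟶ S :=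
        { τ₁ := ε, τ₂ := 𝟙 _, τ₃ := 𝟙 _ }
      have : Epi φ.τ₁ := this
      have : IsIso φ.τ₂ := inferInstanceAs (IsIso (𝟙 _))
      have : Mono φ.τ₃ := inferInstanceAs (Mono (𝟙 _))
      exact (ShortComplex.exact_iff_of_epi_of_isIso_of_mono φ).2 hS.exact)
    (fun i => by
      rw [HomologicalComplex.exactAt_iff' _ (i + 2) (i + 1) i (by simp) (by simp)]
      match i with
      | 0 =>
        let φ : ShortComplex.mk _ _ hε ⟶ ShortComplex.mk _ _ w :=
          { τ₁ := 𝟙 _, τ₂ := 𝟙 _, τ₃ := S.f }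
        have : Epi φ.τ₁ := inferInstanceAs (Epi (𝟙 _))
        have : IsIso φ.τ₂ := inferInstanceAs (IsIso (𝟙 _))
        have : Mono φ.τ₃ := hS.mono_f
        exact (ShortComplex.exact_iff_of_epi_of_isIso_of_mono φ).1 hexact
      | i + 1 => exact Q.exact_succ i)

end CategoryTheory.ProjectiveResolution

end Splice

theorem HasFiniteProjectiveResolution.exists_projectiveResolution {R : Type u} [Ring R] {d : ℕ} :
    ∀ {M : Type u} [AddCommGroup M] [Module R M], HasFiniteProjectiveResolution R d M →
      ∃ P : ProjectiveResolution (ModuleCat.of R M),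
        (∀ i, Module.Finite R (P.complex.X i)) ∧
          ∀ i, d ≤ i → Limits.IsZero (P.complex.X i) := by
  induction d with
  | zero =>
    intro M _ _ h
    have : Subsingleton M := h
    have hM : Limits.IsZero (ModuleCat.of R M) := ModuleCat.isZero_of_subsingleton _
    have : Projective (ModuleCat.of R M) := hM.projective
    have hz : ∀ i, Limits.IsZero ((ProjectiveResolution.self (ModuleCat.of R M)).complex.X i) := by
      intro i
      cases i with
      | zero => exact hM
      | succ i => exact HomologicalComplex.isZero_single_obj_X _ _ _ _ (by simp)
    refine ⟨ProjectiveResolution.self _, fun i => ?_, fun i _ => hz i⟩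
    have := ModuleCat.subsingleton_of_isZero (hz i)
    infer_instance
  | succ d ih =>
    rintro M _ _ ⟨P, _, _, f, hP, hfin, hf, hker⟩
    obtain ⟨Q, hQ, hQ0⟩ := ih hker
    refine ⟨ProjectiveResolution.splice (S := f.shortComplexKer)
      (LinearMap.shortExact_shortComplexKer hf) ((IsProjective.iff_projective P).1 hP) Q, ?_, ?_⟩
    · intro i
      cases i with
      | zero => exact hfin
      | succ i => exact hQ i
    · intro i hi
      cases i with
      | zero => omega
      | succ i => exact hQ0 i (by omega)

end FiniteProjectiveResolutions

/-! ### The inner action on Ext and cyclic Ext groups in a long exact sequence. -/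

section InnerExt

open MulOpposite CategoryTheory Abelian EnvelopingAlgebra

variable {k : Type v} [CommRing k] {A : Type u} [Ring A] [Algebra k A]

/-- The action of `r` on `Ext^i(X, A ⊗ Aᵒᵖ)` induced by its inner action on `A ⊗ Aᵒᵖ`. -/
noncomputable def innerExt {X : ModuleCat.{u} (EnvelopingAlgebra k A)} {i : ℕ}
    (r : EnvelopingAlgebra k A) :
    Ext.{u} X (ModuleCat.of (EnvelopingAlgebra k A) (EnvelopingAlgebra k A)) i →+
      Ext.{u} X (ModuleCat.of (EnvelopingAlgebra k A) (EnvelopingAlgebra k A)) i :=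
  AddMonoidHom.mk' (fun α => α.comp (Ext.mk₀ (innerAction r)) (add_zero i))
    (fun α β => Ext.add_comp α β _ _)

variable {X : ModuleCat.{u} (EnvelopingAlgebra k A)} {i : ℕ}

theorem innerExt_apply (r : EnvelopingAlgebra k A)
    (α : Ext.{u} X (ModuleCat.of (EnvelopingAlgebra k A) (EnvelopingAlgebra k A)) i) :
    innerExt r α = α.comp (Ext.mk₀ (innerAction r)) (add_zero i) := rfl

theorem innerExt_add_apply (r s : EnvelopingAlgebra k A)
    (α : Ext.{u} X (ModuleCat.of (EnvelopingAlgebra k A) (EnvelopingAlgebra k A)) i) :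
    innerExt (r + s) α = innerExt r α + innerExt s α := by
  rw [innerExt_apply, innerAction_add, Ext.mk₀_add, Ext.comp_add]
  rfl

theorem innerExt_sub_apply (r s : EnvelopingAlgebra k A)
    (α : Ext.{u} X (ModuleCat.of (EnvelopingAlgebra k A) (EnvelopingAlgebra k A)) i) :
    innerExt (r - s) α = innerExt r α - innerExt s α := by
  rw [eq_sub_iff_add_eq, ← innerExt_add_apply, sub_add_cancel]

theorem innerExt_mul_apply (r s : EnvelopingAlgebra k A)
    (α : Ext.{u} X (ModuleCat.of (EnvelopingAlgebra k A) (EnvelopingAlgebra k A)) i) :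
    innerExt (r * s) α = innerExt r (innerExt s α) := by
  rw [innerExt_apply, innerAction_mul, ← Ext.mk₀_comp_mk₀,
    ← Ext.comp_assoc_of_third_deg_zero]
  rfl

/-- The inner action is Yoneda composition on the second argument, so it commutes with composition
on the first by associativity. Pullbacks and connecting maps are therefore linear for it. -/
theorem comp_innerExt {Y : ModuleCat.{u} (EnvelopingAlgebra k A)} {j l : ℕ}
    (β : Ext.{u} Y X j) (r : EnvelopingAlgebra k A)
    (α : Ext.{u} X (ModuleCat.of (EnvelopingAlgebra k A) (EnvelopingAlgebra k A)) i)
    (h : j + i = l) : β.comp (innerExt r α) h = innerExt r (β.comp α h) :=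
  (Ext.comp_assoc_of_third_deg_zero β α _ h).symm

/-- `Ext^i(X, A ⊗ Aᵒᵖ)` vanishes for `i ≠ d`, and for `i = d` it is generated by `θ` under the
inner action, with annihilator `K`. -/
structure IsCyclicExt (d : ℕ) (X : ModuleCat.{u} (EnvelopingAlgebra k A))
    (θ : Ext.{u} X (ModuleCat.of (EnvelopingAlgebra k A) (EnvelopingAlgebra k A)) d)
    (K : Submodule (EnvelopingAlgebra k A) (EnvelopingAlgebra k A)) : Prop where
  eq_zero : ∀ (i : ℕ), i ≠ d →
    ∀ α : Ext.{u} X (ModuleCat.of (EnvelopingAlgebra k A) (EnvelopingAlgebra k A)) i, α = 0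
  exists_eq : ∀ α : Ext.{u} X (ModuleCat.of (EnvelopingAlgebra k A) (EnvelopingAlgebra k A)) d,
    ∃ r, α = innerExt r θ
  innerExt_eq_zero_iff : ∀ r, innerExt r θ = 0 ↔ r ∈ K

/-- If `0 → X₁ → X₂ → X₃ → 0` is exact, the `Ext` groups of `X₁` and `X₂` are concentrated in
degree `d` and cyclic there, and the induced map between them is injective, then the `Ext` groups
of `X₃` are concentrated in degree `d + 1` and cyclic there. -/
theorem IsCyclicExt.of_shortExact {d : ℕ}
    {S : ShortComplex (ModuleCat.{u} (EnvelopingAlgebra k A))} (hS : S.ShortExact)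
    {θ₁ : Ext.{u} S.X₁ (ModuleCat.of (EnvelopingAlgebra k A) (EnvelopingAlgebra k A)) d}
    {θ₂ : Ext.{u} S.X₂ (ModuleCat.of (EnvelopingAlgebra k A) (EnvelopingAlgebra k A)) d}
    {K₁ K₂ K₃ : Submodule (EnvelopingAlgebra k A) (EnvelopingAlgebra k A)}
    (h₁ : IsCyclicExt d S.X₁ θ₁ K₁) (h₂ : IsCyclicExt d S.X₂ θ₂ K₂) {w : EnvelopingAlgebra k A}
    (hw : (Ext.mk₀ S.f).comp θ₂ (zero_add d) = innerExt w θ₁)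
    (hreg : ∀ s, s * w ∈ K₁ → s ∈ K₂) (hK₃ : ∀ r, r ∈ K₃ ↔ ∃ s, r - s * w ∈ K₁) :
    IsCyclicExt (d + 1) S.X₃ (hS.extClass.comp θ₁ (add_comm 1 d)) K₃ := by
  have pull : ∀ s, (Ext.mk₀ S.f).comp (innerExt s θ₂) (zero_add d) = innerExt (s * w) θ₁ := by
    intro s
    rw [comp_innerExt, hw, innerExt_mul_apply]
  -- Pullback along `S.g` vanishes in every degree. Outside `d` its target is zero; in degree `d`
  -- exactness puts the image in the kernel of pullback along `S.f`, which is injective by `hreg`.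
  -- The long exact sequence then reduces to `Ext^d(X₂) → Ext^d(X₁) → Ext^{d+1}(X₃) → 0`.
  have key : ∀ (i : ℕ)
      (α : Ext.{u} S.X₃ (ModuleCat.of (EnvelopingAlgebra k A) (EnvelopingAlgebra k A)) i),
      (Ext.mk₀ S.g).comp α (zero_add i) = 0 := by
    intro i α
    by_cases hi : i = d
    · subst hi
      obtain ⟨s, hs⟩ := h₂.exists_eq ((Ext.mk₀ S.g).comp α (zero_add i))
      have h0 : (Ext.mk₀ S.f).comp ((Ext.mk₀ S.g).comp α (zero_add i)) (zero_add i) = 0 := by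
        rw [Ext.mk₀_comp_mk₀_assoc, S.zero, Ext.mk₀_zero, Ext.zero_comp]
      rw [hs, pull, h₁.innerExt_eq_zero_iff] at h0
      rw [hs, h₂.innerExt_eq_zero_iff]
      exact hreg s h0
    · exact h₂.eq_zero i hi _
  refine ⟨?_, ?_, ?_⟩
  · intro i hi α
    cases i with
    | zero =>
      -- No connecting map ends in degree `0`; there, pullback along an epimorphism is injective as
      -- well as zero.
      have := hS.epi_g
      apply Ext.precomp_mk₀_injective_of_epi _ S.g
      exact (key 0 α).trans (key 0 0).symm
    | succ i =>
      obtain ⟨x, rfl⟩ := Ext.contravariant_sequence_exact₃ hS _ α (key _ α) (add_comm 1 i)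
      rw [h₁.eq_zero i (fun h => hi (by rw [h])) x, Ext.comp_zero]
  · intro α
    obtain ⟨x, rfl⟩ := Ext.contravariant_sequence_exact₃ hS _ α (key _ α) (add_comm 1 d)
    obtain ⟨r, rfl⟩ := h₁.exists_eq x
    exact ⟨r, comp_innerExt _ _ _ _⟩
  · intro r
    rw [← comp_innerExt, hK₃]
    constructor
    · intro h
      obtain ⟨y, hy⟩ := Ext.contravariant_sequence_exact₁ hS _ _ _ h
      obtain ⟨s, rfl⟩ := h₂.exists_eq y
      refine ⟨s, ?_⟩
      rw [← h₁.innerExt_eq_zero_iff, innerExt_sub_apply, ← pull, hy, sub_self]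
    · rintro ⟨s, hs⟩
      rw [← h₁.innerExt_eq_zero_iff, innerExt_sub_apply, sub_eq_zero] at hs
      rw [hs, ← pull, hS.extClass_comp_assoc]

theorem IsCyclicExt.of_iso {d : ℕ} {X Y : ModuleCat.{u} (EnvelopingAlgebra k A)} (e : Y ≅ X)
    {θ : Ext.{u} X (ModuleCat.of (EnvelopingAlgebra k A) (EnvelopingAlgebra k A)) d}
    {K : Submodule (EnvelopingAlgebra k A) (EnvelopingAlgebra k A)} (h : IsCyclicExt d X θ K) :
    IsCyclicExt d Y ((Ext.mk₀ e.hom).comp θ (zero_add d)) K := by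
  have h1 : ∀ {i : ℕ}
      (α : Ext.{u} Y (ModuleCat.of (EnvelopingAlgebra k A) (EnvelopingAlgebra k A)) i),
      (Ext.mk₀ e.hom).comp ((Ext.mk₀ e.inv).comp α (zero_add i)) (zero_add i) = α := by
    intro i α
    rw [Ext.mk₀_comp_mk₀_assoc, e.hom_inv_id, Ext.mk₀_id_comp]
  have h2 : ∀ {i : ℕ}
      (α : Ext.{u} X (ModuleCat.of (EnvelopingAlgebra k A) (EnvelopingAlgebra k A)) i),
      (Ext.mk₀ e.inv).comp ((Ext.mk₀ e.hom).comp α (zero_add i)) (zero_add i) = α := by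
    intro i α
    rw [Ext.mk₀_comp_mk₀_assoc, e.inv_hom_id, Ext.mk₀_id_comp]
  refine ⟨?_, ?_, ?_⟩
  · intro i hi α
    rw [← h1 α, h.eq_zero i hi ((Ext.mk₀ e.inv).comp α (zero_add i)), Ext.comp_zero]
  · intro α
    obtain ⟨r, hr⟩ := h.exists_eq ((Ext.mk₀ e.inv).comp α (zero_add d))
    exact ⟨r, by rw [← comp_innerExt, ← hr, h1]⟩
  · intro r
    rw [← comp_innerExt, ← h.innerExt_eq_zero_iff]
    constructor
    · intro h0
      rw [← h2 (innerExt r θ), h0, Ext.comp_zero]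
    · intro h0
      rw [h0, Ext.comp_zero]

end InnerExt

/-! ### The modules `M(S, κ)` and their short exact sequences. -/

section SkewQuotients

open MulOpposite CategoryTheory Abelian EnvelopingAlgebra

namespace QuantumAffineSpace

variable {k : Type u} [CommRing k] {n : ℕ} {q : Matrix (Fin n) (Fin n) k}

variable (q) in
/-- The quotient of the enveloping algebra by the left ideal `skewIdeal q S κ`. -/
noncomputable abbrev skewQuotient (S : Finset (Fin n)) (κ : Fin n → k) :
    ModuleCat.{u} (EnvelopingAlgebra k (QuantumAffineSpace q)) :=
  ModuleCat.of _ (EnvelopingAlgebra k (QuantumAffineSpace q) ⧸ skewIdeal q S κ)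

/-- Right multiplication by `s (x_j ⊗ 1) - t (1 ⊗ x_j)` between quotients. -/
noncomputable def skewMul (hq_inv : ∀ i j, q i j * q j i = 1) (S : Finset (Fin n))
    {κ κ' : Fin n → k} {j : Fin n} (h : ∀ i, κ' i = q j i * κ i) (s t : k) :
    (EnvelopingAlgebra k (QuantumAffineSpace q) ⧸ skewIdeal q S κ')
      →ₗ[EnvelopingAlgebra k (QuantumAffineSpace q)]
    (EnvelopingAlgebra k (QuantumAffineSpace q) ⧸ skewIdeal q S κ) :=
  Submodule.mapQ _ _ (LinearMap.toSpanSingleton _ _ (s • xl q j - t • xr q j))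
    (fun _ hr => mul_mem_skewIdeal hq_inv (fun i _ => h i) s t hr)

theorem skewMul_mk (hq_inv : ∀ i j, q i j * q j i = 1) (S : Finset (Fin n))
    {κ κ' : Fin n → k} {j : Fin n} (h : ∀ i, κ' i = q j i * κ i) (s t : k)
    (r : EnvelopingAlgebra k (QuantumAffineSpace q)) :
    skewMul hq_inv S h s t (Submodule.Quotient.mk r) =
      Submodule.Quotient.mk (r * (s • xl q j - t • xr q j)) := rfl

/-- The projection `M(S, κ) → M(S ∪ {j}, κ)`. -/
noncomputable def skewProj (S : Finset (Fin n)) (κ : Fin n → k) (j : Fin n) :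
    (EnvelopingAlgebra k (QuantumAffineSpace q) ⧸ skewIdeal q S κ)
      →ₗ[EnvelopingAlgebra k (QuantumAffineSpace q)]
    (EnvelopingAlgebra k (QuantumAffineSpace q) ⧸ skewIdeal q (insert j S) κ) :=
  Submodule.factor (skewIdeal_mono (Finset.subset_insert j S) κ)

theorem skewProj_mk (S : Finset (Fin n)) (κ : Fin n → k) (j : Fin n)
    (r : EnvelopingAlgebra k (QuantumAffineSpace q)) :
    skewProj S κ j (Submodule.Quotient.mk r) = Submodule.Quotient.mk r := rfl

theorem skewProj_surjective (S : Finset (Fin n)) (κ : Fin n → k) (j : Fin n) :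
    Function.Surjective (skewProj (q := q) S κ j) :=
  Submodule.factor_surjective (skewIdeal_mono (Finset.subset_insert j S) κ)

theorem skewMul_injective (hq_diag : ∀ i, q i i = 1) (hq_inv : ∀ i j, q i j * q j i = 1)
    {S : Finset (Fin n)} {κ κ' : Fin n → k} {j : Fin n} (hj : j ∉ S)
    (h : ∀ i, κ' i = q j i * κ i) : Function.Injective (skewMul hq_inv S h 1 (κ j)) := by
  refine (injective_iff_map_eq_zero _).2 fun m hm => ?_
  obtain ⟨r, rfl⟩ := Submodule.Quotient.mk_surjective _ m
  rw [skewMul_mk, Submodule.Quotient.mk_eq_zero, one_smul] at hm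
  rw [Submodule.Quotient.mk_eq_zero, skewIdeal_congr (fun i _ => h i)]
  exact mem_skewIdeal_of_mul_mem hq_diag hq_inv hj κ _ hm

theorem exact_skewMul_skewProj (hq_inv : ∀ i j, q i j * q j i = 1)
    {S : Finset (Fin n)} {κ κ' : Fin n → k} {j : Fin n} (h : ∀ i, κ' i = q j i * κ i) :
    Function.Exact (skewMul hq_inv S h 1 (κ j)) (skewProj S κ j) := by
  intro m
  obtain ⟨r, rfl⟩ := Submodule.Quotient.mk_surjective _ m
  rw [skewProj_mk, Submodule.Quotient.mk_eq_zero, mem_skewIdeal_insert]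
  constructor
  · rintro ⟨s, hs⟩
    refine ⟨Submodule.Quotient.mk s, ?_⟩
    rw [skewMul_mk, one_smul]
    exact ((Submodule.Quotient.eq _).2 hs).symm
  · rintro ⟨m, hm⟩
    obtain ⟨s, rfl⟩ := Submodule.Quotient.mk_surjective _ m
    rw [skewMul_mk, one_smul] at hm
    exact ⟨s, (Submodule.Quotient.eq _).1 hm.symm⟩

/-- The sequence `M(S, κ') → M(S, κ) → M(S ∪ {j}, κ)`. -/
noncomputable def skewComplex (hq_inv : ∀ i j, q i j * q j i = 1) (S : Finset (Fin n))
    {κ κ' : Fin n → k} {j : Fin n} (h : ∀ i, κ' i = q j i * κ i) :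
    ShortComplex (ModuleCat.{u} (EnvelopingAlgebra k (QuantumAffineSpace q))) where
  X₁ := skewQuotient q S κ'
  X₂ := skewQuotient q S κ
  X₃ := skewQuotient q (insert j S) κ
  f := ModuleCat.ofHom (skewMul hq_inv S h 1 (κ j))
  g := ModuleCat.ofHom (skewProj S κ j)
  zero := ModuleCat.hom_ext (exact_skewMul_skewProj hq_inv h).linearMap_comp_eq_zero

theorem skewComplex_shortExact (hq_diag : ∀ i, q i i = 1) (hq_inv : ∀ i j, q i j * q j i = 1)
    {S : Finset (Fin n)} {κ κ' : Fin n → k} {j : Fin n} (hj : j ∉ S)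
    (h : ∀ i, κ' i = q j i * κ i) : (skewComplex hq_inv S h).ShortExact :=
  ModuleCat.shortComplex_shortExact _ (exact_skewMul_skewProj hq_inv h)
    (skewMul_injective hq_diag hq_inv hj h) (skewProj_surjective S κ j)

/-- Right multiplication as a morphism of the sequences `skewComplex`. -/
noncomputable def skewComplexMap (hq_inv : ∀ i j, q i j * q j i = 1) (S : Finset (Fin n))
    {κ κ₁ κ₂ κ₃ : Fin n → k} {i j : Fin n} (h₁ : ∀ l, κ₁ l = q i l * κ l)
    (h₂ : ∀ l, κ₂ l = q j l * κ l) (h₃ : ∀ l, κ₃ l = q i l * κ₂ l)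
    (h₃' : ∀ l, κ₃ l = q j l * κ₁ l) (s t : k) :
    skewComplex hq_inv S h₃ ⟶ skewComplex hq_inv S h₁ where
  -- The factor `q j i` is the one `skewGen_mul` produces when the form in `j` crosses the form in
  -- `i`. It is the source of the products in the Nakayama automorphism.
  τ₁ := ModuleCat.ofHom (skewMul hq_inv S h₃' (s * q j i) t)
  τ₂ := ModuleCat.ofHom (skewMul hq_inv S h₂ s t)
  τ₃ := ModuleCat.ofHom (skewMul hq_inv (insert i S) h₂ s t)
  comm₁₂ := by
    refine ModuleCat.hom_ext (LinearMap.ext fun m => ?_)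
    obtain ⟨r, rfl⟩ := Submodule.Quotient.mk_surjective _ m
    change Submodule.Quotient.mk (r * ((s * q j i) • xl q j - t • xr q j) *
      ((1 : k) • xl q i - κ i • xr q i)) = Submodule.Quotient.mk (r * ((1 : k) • xl q i -
      κ₂ i • xr q i) * (s • xl q j - t • xr q j))
    rw [mul_assoc, mul_assoc, h₂, one_smul, skewGen_mul hq_inv]
  comm₂₃ := by
    refine ModuleCat.hom_ext (LinearMap.ext fun m => ?_)
    obtain ⟨r, rfl⟩ := Submodule.Quotient.mk_surjective _ m
    rfl

theorem skewIdeal_empty (κ : Fin n → k) : skewIdeal q ∅ κ = ⊥ := by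
  simp [skewIdeal]

/-- Each index lengthens the resolution by one. The bound counts terms, hence `S.card + 1` with the
free module as the case `S = ∅`. -/
theorem hasFiniteProjectiveResolution_skewQuotient (hq_diag : ∀ i, q i i = 1)
    (hq_inv : ∀ i j, q i j * q j i = 1) (S : Finset (Fin n)) : ∀ κ : Fin n → k,
    HasFiniteProjectiveResolution (EnvelopingAlgebra k (QuantumAffineSpace q)) (S.card + 1)
      (EnvelopingAlgebra k (QuantumAffineSpace q) ⧸ skewIdeal q S κ) := by
  induction S using Finset.induction_on with
  | empty =>
    intro κ
    exact (HasFiniteProjectiveResolution.of_projective _).of_equiv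
      (Submodule.quotEquivOfEqBot _ (skewIdeal_empty κ)).symm
  | insert j S hj ih =>
    intro κ
    rw [Finset.card_insert_of_notMem hj]
    exact HasFiniteProjectiveResolution.of_cokernel _ _
      (skewMul_injective (κ := κ) hq_diag hq_inv hj (fun i => rfl)) (skewProj_surjective S κ j)
      (exact_skewMul_skewProj hq_inv (fun i => rfl)) (ih _) (ih κ).succ

end QuantumAffineSpace

end SkewQuotients

/-! ### Inductive computation of `Ext(M(S, κ), A^e)` with its inner structure. -/

section KoszulExt

open MulOpposite CategoryTheory Abelian EnvelopingAlgebra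

theorem EnvelopingAlgebra.neg_smul {k A : Type*} [CommRing k] [Ring A] [Algebra k A] (c : k)
    (r : EnvelopingAlgebra k A) : -c • r = -(c • r) :=
  eq_neg_of_add_eq_zero_left (by rw [← add_smul, neg_add_cancel, zero_smul])

namespace QuantumAffineSpace

theorem flipOp_sub_smul {k : Type u} [CommRing k] {n : ℕ} (q : Matrix (Fin n) (Fin n) k)
    (j : Fin n) (s t : k) :
    (flipOp k (QuantumAffineSpace q) (s • xr q j - t • xl q j)).unop =
      s • xl q j - t • xr q j := by
  rw [map_sub, map_smul, map_smul]
  rfl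

variable {k : Type u} [Field k] {n : ℕ} {q : Matrix (Fin n) (Fin n) k}

variable (q) in
/-- The parameters of the annihilator of the generator of `Ext`. -/
noncomputable def dualParam (S : Finset (Fin n)) (κ : Fin n → k) (i : Fin n) : k :=
  (∏ l ∈ S, q i l) / κ i

/-- The classes `θ κ` generate the `Ext` groups of the quotients `M(S, κ)`, compatibly with right
multiplications. -/
structure IsKoszulClass (hq_inv : ∀ i j, q i j * q j i = 1) (S : Finset (Fin n)) (d : ℕ)
    (θ : ∀ κ : Fin n → k, Ext.{u} (skewQuotient q S κ)
      (ModuleCat.of (EnvelopingAlgebra k (QuantumAffineSpace q))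
        (EnvelopingAlgebra k (QuantumAffineSpace q))) d) : Prop where
  isCyclicExt : ∀ κ, (∀ i, κ i ≠ 0) →
    IsCyclicExt d (skewQuotient q S κ) (θ κ) (skewIdeal q S (dualParam q S κ))
  -- The inner action exchanges left and right factors, so the coefficient `s` of `x_j ⊗ 1`
  -- reappears on `1 ⊗ x_j`. It picks up `q j l` for each index `l` already in `S`. Arbitrary `s`
  -- and `t` are needed because the induction replaces `s` by a multiple.
  naturality : ∀ (κ κ' : Fin n → k) (j : Fin n) (h : ∀ i, κ' i = q j i * κ i), j ∉ S →
    ∀ s t : k, (Ext.mk₀ (ModuleCat.ofHom (skewMul hq_inv S h s t))).comp (θ κ) (zero_add d) =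
      innerExt ((s * ∏ l ∈ S, q j l) • xr q j - t • xl q j) (θ κ')

theorem exists_isKoszulClass_empty (hq_inv : ∀ i j, q i j * q j i = 1) :
    ∃ θ, IsKoszulClass hq_inv ∅ 0 θ := by
  let e : ∀ κ : Fin n → k, (EnvelopingAlgebra k (QuantumAffineSpace q) ⧸ skewIdeal q ∅ κ) ≃ₗ[
      EnvelopingAlgebra k (QuantumAffineSpace q)] EnvelopingAlgebra k (QuantumAffineSpace q) :=
    fun κ => Submodule.quotEquivOfEqBot _ (skewIdeal_empty κ)
  have hcomp : ∀ κ r, innerExt r (Ext.mk₀ (ModuleCat.ofHom (e κ).toLinearMap)) =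
      Ext.mk₀ (ModuleCat.ofHom (e κ).toLinearMap ≫ innerAction r) :=
    fun κ r => Ext.mk₀_comp_mk₀ _ _
  refine ⟨fun κ => Ext.mk₀ (ModuleCat.ofHom (e κ).toLinearMap), ⟨fun κ _ => ⟨?_, ?_, ?_⟩, ?_⟩⟩
  · intro i hi α
    obtain ⟨i, rfl⟩ := Nat.exists_eq_succ_of_ne_zero hi
    have : Module.Projective (EnvelopingAlgebra k (QuantumAffineSpace q))
        (EnvelopingAlgebra k (QuantumAffineSpace q) ⧸ skewIdeal q ∅ κ) :=
      Module.Projective.of_equiv (e κ).symm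
    have : Projective (skewQuotient q ∅ κ) := (IsProjective.iff_projective _).1 this
    exact Ext.eq_zero_of_projective α
  · intro α
    obtain ⟨f, rfl⟩ := (Ext.mk₀_bijective _ _).2 α
    -- A map out of the free module is right multiplication by the image of `1`; the inverse flip
    -- rewrites that as an inner action.
    refine ⟨(flipOp k (QuantumAffineSpace q)).symm (op (f.hom (Submodule.Quotient.mk 1))), ?_⟩
    rw [hcomp]
    refine congrArg _ (ModuleCat.hom_ext (LinearMap.ext fun m => ?_))
    obtain ⟨r, rfl⟩ := Submodule.Quotient.mk_surjective _ m
    change f.hom (Submodule.Quotient.mk r) = 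
      r * (flipOp k (QuantumAffineSpace q) ((flipOp k (QuantumAffineSpace q)).symm _)).unop
    rw [AlgEquiv.apply_symm_apply, unop_op, ← smul_eq_mul, ← map_smul,
      ← Submodule.Quotient.mk_smul, smul_eq_mul, mul_one]
  · intro r
    rw [hcomp, Ext.mk₀_eq_zero_iff, skewIdeal_empty (dualParam q ∅ κ), Submodule.mem_bot]
    constructor
    · intro h
      have h1 : (1 : EnvelopingAlgebra k (QuantumAffineSpace q)) * (flipOp k _ r).unop = 0 :=
        LinearMap.congr_fun (ModuleCat.hom_ext_iff.1 h) (Submodule.Quotient.mk 1)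
      rw [one_mul, unop_eq_zero_iff] at h1
      exact (flipOp k _).injective (h1.trans (map_zero _).symm)
    · rintro rfl
      rw [innerAction_zero, Limits.comp_zero]
  · intro κ κ' j h _ s t
    rw [hcomp, Ext.mk₀_comp_mk₀]
    refine congrArg _ (ModuleCat.hom_ext (LinearMap.ext fun m => ?_))
    obtain ⟨r, rfl⟩ := Submodule.Quotient.mk_surjective _ m
    change r * (s • xl q j - t • xr q j) = r * (flipOp k _ _).unop
    rw [flipOp_sub_smul, Finset.prod_empty, mul_one]

/-- For `i ∈ S`, the new factor `q_{ij}` in the numerator equals the factor `q_{ji}` in the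
denominator that comes from rescaling `κ`. For the index `j`, `q_{jj} = 1` makes the new generator a
nonzero multiple of the element by which pullback acts. -/
theorem mem_skewIdeal_dualParam_insert (hq_diag : ∀ i, q i i = 1)
    (hq_inv : ∀ i j, q i j * q j i = 1) {S : Finset (Fin n)} {j : Fin n} (hj : j ∉ S)
    {κ : Fin n → k} (hκ : ∀ i, κ i ≠ 0) (r : EnvelopingAlgebra k (QuantumAffineSpace q)) :
    r ∈ skewIdeal q (insert j S) (dualParam q (insert j S) κ) ↔
      ∃ s, r - s * ((1 * ∏ l ∈ S, q j l) • xr q j - κ j • xl q j) ∈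
        skewIdeal q S (dualParam q S fun i => q j i * κ i) := by
  have hcongr : skewIdeal q S (dualParam q (insert j S) κ) =
      skewIdeal q S (dualParam q S fun i => q j i * κ i) := by
    refine skewIdeal_congr fun i _ => ?_
    have h0 : q j i ≠ 0 := left_ne_zero_of_mul_eq_one (hq_inv j i)
    rw [dualParam, dualParam, Finset.prod_insert hj, div_eq_div_iff (hκ i) (mul_ne_zero h0 (hκ i))]
    linear_combination (κ i * ∏ l ∈ S, q i l) * hq_inv i j
  have hgen : ∀ s : EnvelopingAlgebra k (QuantumAffineSpace q),
      ((-κ j) • s) * (xl q j - dualParam q (insert j S) κ j • xr q j) =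
        s * ((1 * ∏ l ∈ S, q j l) • xr q j - κ j • xl q j) := by
    intro s
    have h1 : -κ j * dualParam q (insert j S) κ j = -∏ l ∈ S, q j l := by
      rw [dualParam, Finset.prod_insert hj, hq_diag, one_mul, neg_mul, mul_div_cancel₀ _ (hκ j)]
    rw [mul_sub, mul_sub, smul_mul_smul_comm, h1, one_mul, mul_smul_comm, mul_smul_comm,
      smul_mul_assoc, EnvelopingAlgebra.neg_smul, EnvelopingAlgebra.neg_smul]
    abel
  rw [mem_skewIdeal_insert, hcongr]
  constructor
  · rintro ⟨s, hs⟩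
    refine ⟨(-κ j)⁻¹ • s, ?_⟩
    rwa [← hgen, smul_smul, mul_inv_cancel₀ (neg_ne_zero.2 (hκ j)), one_smul]
  · rintro ⟨s, hs⟩
    exact ⟨(-κ j) • s, by rwa [hgen]⟩

/-- After division by `-κ_j` this is `mem_skewIdeal_of_mul_mem` for the dual parameters: the
rescaling by `q_{ji}` in its conclusion cancels the one applied to `κ`. It supplies the injectivity
required by `IsCyclicExt.of_shortExact`. -/
theorem mem_skewIdeal_dualParam_of_mul_mem (hq_diag : ∀ i, q i i = 1)
    (hq_inv : ∀ i j, q i j * q j i = 1) {S : Finset (Fin n)} {j : Fin n} (hj : j ∉ S)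
    {κ : Fin n → k} (hκ : ∀ i, κ i ≠ 0) (s : EnvelopingAlgebra k (QuantumAffineSpace q))
    (hs : s * ((1 * ∏ l ∈ S, q j l) • xr q j - κ j • xl q j) ∈
      skewIdeal q S (dualParam q S fun i => q j i * κ i)) :
    s ∈ skewIdeal q S (dualParam q S κ) := by
  have hgen : (-(κ j)⁻¹) • (s * ((1 * ∏ l ∈ S, q j l) • xr q j - κ j • xl q j)) =
      s * (xl q j - ((κ j)⁻¹ * ∏ l ∈ S, q j l) • xr q j) := by
    rw [← mul_smul_comm, smul_sub, smul_smul, smul_smul, one_mul, neg_mul, neg_mul,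
      inv_mul_cancel₀ (hκ j), EnvelopingAlgebra.neg_smul, EnvelopingAlgebra.neg_smul, one_smul]
    congr 1
    abel
  have h1 := mem_skewIdeal_of_mul_mem hq_diag hq_inv hj _ _ (hgen ▸
    (skewIdeal q S (dualParam q S fun i => q j i * κ i)).smul_of_tower_mem (-(κ j)⁻¹) hs)
  rwa [skewIdeal_congr (κ' := dualParam q S κ)] at h1
  intro i _
  have h0 : q j i ≠ 0 := left_ne_zero_of_mul_eq_one (hq_inv j i)
  rw [dualParam, dualParam, mul_div_assoc', mul_div_mul_left _ _ h0]

theorem exists_isKoszulClass_insert (hq_diag : ∀ i, q i i = 1)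
    (hq_inv : ∀ i j, q i j * q j i = 1) {S : Finset (Fin n)} {d : ℕ} {j : Fin n} (hj : j ∉ S)
    (h : ∃ θ, IsKoszulClass hq_inv S d θ) :
    ∃ θ, IsKoszulClass hq_inv (insert j S) (d + 1) θ := by
  obtain ⟨θ, hθ⟩ := h
  have hE : ∀ κ κ' : Fin n → k, ∀ h : (∀ i, κ' i = q j i * κ i),
      (skewComplex hq_inv S h).ShortExact :=
    fun κ κ' h => skewComplex_shortExact hq_diag hq_inv hj h
  refine ⟨fun κ => (hE κ _ fun i => rfl).extClass.comp (θ fun i => q j i * κ i) (add_comm 1 d),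
    ⟨fun κ hκ => ?_, ?_⟩⟩
  · have hκ' : ∀ i, q j i * κ i ≠ 0 :=
      fun i => mul_ne_zero (left_ne_zero_of_mul_eq_one (hq_inv j i)) (hκ i)
    exact IsCyclicExt.of_shortExact (hE κ _ fun i => rfl) (hθ.isCyclicExt _ hκ')
      (hθ.isCyclicExt _ hκ) (hθ.naturality κ _ j (fun i => rfl) hj 1 (κ j))
      (mem_skewIdeal_dualParam_of_mul_mem hq_diag hq_inv hj hκ)
      (mem_skewIdeal_dualParam_insert hq_diag hq_inv hj hκ)
  · intro κ κ' l h hl s t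
    have hlS : l ∉ S := fun h' => hl (Finset.mem_insert_of_mem h')
    -- The new generator is the connecting image of the old one, so its behaviour under right
    -- multiplication follows from naturality of the extension class along `skewComplexMap`.
    have hnat := (hE κ' _ fun i => rfl).extClass_naturality (hE κ _ fun i => rfl)
      (skewComplexMap hq_inv S (fun i => rfl) h (fun i => rfl)
        (fun i => by rw [h i, mul_left_comm]) s t)
    have h2 := hθ.naturality (fun i => q j i * κ i) (fun i => q j i * κ' i) l
      (fun i => by rw [h i, mul_left_comm]) hlS (s * q l j) t
    -- The factor `q l j` acquired by the left-hand map extends the product from `S` to `insert j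
    -- S`.
    rw [mul_assoc, ← Finset.prod_insert hj] at h2
    have h3 := Ext.comp_assoc (a₁₂ := 1) (a₂₃ := d) (a := d + 1)
      (hE κ' _ fun i => rfl).extClass (Ext.mk₀ (skewComplexMap hq_inv S (fun i => rfl) h
        (fun i => rfl) (fun i => by rw [h i, mul_left_comm]) s t).τ₁) (θ fun i => q j i * κ i)
      (add_zero 1) (zero_add d) (by omega)
    have h4 := Ext.comp_assoc (a₁₂ := 1) (a₂₃ := d + 1) (a := d + 1)
      (Ext.mk₀ (skewComplexMap hq_inv S (fun i => rfl) h
        (fun i => rfl) (fun i => by rw [h i, mul_left_comm]) s t).τ₃)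
      (hE κ _ fun i => rfl).extClass (θ fun i => q j i * κ i)
      (zero_add 1) (add_comm 1 d) (by omega)
    exact h4.symm.trans ((congrArg (fun x => Ext.comp x (θ fun i => q j i * κ i)
      (add_comm 1 d)) hnat.symm).trans (h3.trans ((congrArg (fun x => Ext.comp
        (hE κ' _ fun i => rfl).extClass x (add_comm 1 d)) h2).trans (comp_innerExt _ _ _ _))))

theorem exists_isKoszulClass (hq_diag : ∀ i, q i i = 1)
    (hq_inv : ∀ i j, q i j * q j i = 1) (S : Finset (Fin n)) :
    ∃ θ, IsKoszulClass hq_inv S S.card θ := by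
  induction S using Finset.induction_on with
  | empty => exact exists_isKoszulClass_empty hq_inv
  | insert j S hj ih =>
    rw [Finset.card_insert_of_notMem hj]
    exact exists_isKoszulClass_insert hq_diag hq_inv hj ih

end QuantumAffineSpace

end KoszulExt

/-! ### The multigrading and the units of quantum affine space. -/

section Units

namespace QuantumAffineSpace

variable {k : Type v} [Field k] {n : ℕ} {q : Matrix (Fin n) (Fin n) k}

instance : Nontrivial (QuantumAffineSpace q) :=
  (lift (fun _ => (0 : k)) (by simp) : QuantumAffineSpace q →ₐ[k] k).toRingHom.domain_nontrivial

variable (q) in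
/-- The product of the generators along a list of indices. -/
noncomputable def word (l : List (Fin n)) : QuantumAffineSpace q := (l.map (x q)).prod

theorem word_append (l l' : List (Fin n)) : word q (l ++ l') = word q l * word q l' := by
  simp [word]

theorem word_singleton (i : Fin n) : word q [i] = x q i := by
  simp [word]

theorem word_cons (i : Fin n) (l : List (Fin n)) : word q (i :: l) = x q i * word q l := by
  simp [word]

theorem exists_word_eq_smul_of_perm {l l' : List (Fin n)} (h : l.Perm l') :
    ∃ c : k, word q l = c • word q l' := by
  induction h with
  | nil => exact ⟨1, (one_smul _ _).symm⟩
  | cons i _ ih =>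
    obtain ⟨c, hc⟩ := ih
    exact ⟨c, by rw [word_cons, word_cons, hc, mul_smul_comm]⟩
  | swap i j l =>
    exact ⟨q i j, by
      rw [word_cons, word_cons, word_cons, word_cons, ← mul_assoc, ← mul_assoc, x_mul_x i j,
        smul_mul_assoc]⟩
  | trans _ _ ih ih' =>
    obtain ⟨c, hc⟩ := ih
    obtain ⟨c', hc'⟩ := ih'
    exact ⟨c * c', by rw [hc, hc', smul_smul]⟩

/-- Right division by the last letter recovers the shorter word, so no basis of ordered monomials is
needed. -/
theorem word_ne_zero (hq_diag : ∀ i, q i i = 1) (hq_inv : ∀ i j, q i j * q j i = 1)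
    (l : List (Fin n)) : word q l ≠ 0 := by
  induction l using List.reverseRecOn with
  | nil => simp [word]
  | append_singleton l i ih =>
    intro h
    rw [word_append, word_singleton] at h
    exact ih (by rw [← rightDiv_mul_x_self hq_diag hq_inv i (word q l), h, map_zero])

theorem span_range_word : Submodule.span k (Set.range (word q)) = ⊤ := by
  refine (Submodule.eq_top_iff').2 fun a => ?_
  induction a using induction_mul_right with
  | one => exact Submodule.subset_span ⟨[], by simp [word]⟩
  | add a b ha hb => exact add_mem ha hb
  | smul c a ha => exact Submodule.smul_mem _ c ha
  | mul_x a i ha =>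
    induction ha using Submodule.span_induction with
    | mem y hy =>
      obtain ⟨l, rfl⟩ := hy
      exact Submodule.subset_span ⟨l ++ [i], by rw [word_append, word_singleton]⟩
    | zero => rw [zero_mul]; exact zero_mem _
    | add y z _ _ hy hz => rw [add_mul]; exact add_mem hy hz
    | smul c y _ hy => rw [smul_mul_assoc]; exact Submodule.smul_mem _ c hy

/-- The multidegree of a word. -/
noncomputable def wordDegree (l : List (Fin n)) : Fin n →₀ ℕ := Multiset.toFinsupp (l : Multiset _)

theorem wordDegree_append (l l' : List (Fin n)) :
    wordDegree (l ++ l') = wordDegree l + wordDegree l' := by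
  rw [wordDegree, ← Multiset.coe_add, map_add]
  rfl

theorem wordDegree_singleton (i : Fin n) : wordDegree [i] = Finsupp.single i 1 :=
  Multiset.toFinsupp_singleton i

theorem perm_of_wordDegree_eq {l l' : List (Fin n)} (h : wordDegree l = wordDegree l') :
    l.Perm l' :=
  Multiset.coe_eq_coe.1 (Multiset.toFinsupp.injective h)

theorem exists_wordDegree_eq (a : Fin n →₀ ℕ) : ∃ l, wordDegree l = a :=
  ⟨(Multiset.toFinsupp.symm a).toList, by
    rw [wordDegree, Multiset.coe_toList, AddEquiv.apply_symm_apply]⟩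

variable (q) in
/-- The decomposition into multihomogeneous components. -/
noncomputable def decompose :
    QuantumAffineSpace q →ₐ[k] AddMonoidAlgebra (QuantumAffineSpace q) (Fin n →₀ ℕ) :=
  lift (fun i => AddMonoidAlgebra.single (Finsupp.single i 1) (x q i)) (by
    intro i j
    rw [AddMonoidAlgebra.single_mul_single, AddMonoidAlgebra.single_mul_single, x_mul_x i j,
      AddMonoidAlgebra.smul_single, add_comm])

theorem decompose_word (l : List (Fin n)) :
    decompose q (word q l) = AddMonoidAlgebra.single (wordDegree l) (word q l) := by
  induction l using List.reverseRecOn with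
  | nil => simp [word, wordDegree, AddMonoidAlgebra.one_def]
  | append_singleton l i ih =>
    rw [word_append, word_singleton, map_mul, ih, decompose, lift_x,
      AddMonoidAlgebra.single_mul_single, wordDegree_append, wordDegree_singleton]

/-- Words of equal multidegree are permutations of each other and hence proportional, so each
homogeneous component is at most one-dimensional. -/
theorem exists_coeff_decompose_eq (a : QuantumAffineSpace q) (l : List (Fin n)) :
    ∃ c : k, (decompose q a).coeff (wordDegree l) = c • word q l := by
  have ha : a ∈ Submodule.span k (Set.range (word q)) := by
    rw [span_range_word]; exact Submodule.mem_top
  induction ha using Submodule.span_induction with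
  | mem y hy =>
    obtain ⟨l', rfl⟩ := hy
    rw [decompose_word]
    by_cases h : wordDegree l' = wordDegree l
    · obtain ⟨c, hc⟩ := exists_word_eq_smul_of_perm (q := q) (perm_of_wordDegree_eq h)
      exact ⟨c, by rw [h, ← hc]; simp⟩
    · exact ⟨0, by simp [h]⟩
  | zero => exact ⟨0, by simp⟩
  | add y z _ _ hy hz =>
    obtain ⟨c, hc⟩ := hy
    obtain ⟨c', hc'⟩ := hz
    exact ⟨c + c', by rw [map_add, AddMonoidAlgebra.coeff_add, Finsupp.add_apply, hc, hc', add_smul]⟩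
  | smul s y _ hy =>
    obtain ⟨c, hc⟩ := hy
    exact ⟨s * c, by
      rw [map_smul, AddMonoidAlgebra.coeff_smul, Finsupp.smul_apply, hc, smul_smul]⟩

theorem sum_coeff_decompose (a : QuantumAffineSpace q) :
    (decompose q a).coeff.sum (fun _ b => b) = a := by
  have ha : a ∈ Submodule.span k (Set.range (word q)) := by
    rw [span_range_word]; exact Submodule.mem_top
  induction ha using Submodule.span_induction with
  | mem y hy =>
    obtain ⟨l, rfl⟩ := hy
    rw [decompose_word]
    simp
  | zero => simp
  | add y z _ _ hy hz =>
    rw [map_add, AddMonoidAlgebra.coeff_add, Finsupp.sum_add_index' (fun _ => rfl)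
      (fun _ _ _ => rfl), hy, hz]
  | smul s y _ hy =>
    rw [map_smul, AddMonoidAlgebra.coeff_smul, Finsupp.sum_smul_index' (fun _ => rfl)]
    conv_rhs => rw [← hy]
    rw [Finsupp.smul_sum]

theorem coeff_decompose_mul_ne_zero (hq_diag : ∀ i, q i i = 1)
    (hq_inv : ∀ i j, q i j * q j i = 1) {a b : QuantumAffineSpace q} {d e : Fin n →₀ ℕ}
    (ha : (decompose q a).coeff d ≠ 0) (hb : (decompose q b).coeff e ≠ 0) :
    (decompose q a).coeff d * (decompose q b).coeff e ≠ 0 := by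
  obtain ⟨l, rfl⟩ := exists_wordDegree_eq d
  obtain ⟨l', rfl⟩ := exists_wordDegree_eq e
  obtain ⟨c, hc⟩ := exists_coeff_decompose_eq a l
  obtain ⟨c', hc'⟩ := exists_coeff_decompose_eq b l'
  rw [hc] at ha ⊢
  rw [hc'] at hb ⊢
  rw [smul_mul_smul_comm, ← word_append]
  exact smul_ne_zero (mul_ne_zero (left_ne_zero_of_smul ha) (left_ne_zero_of_smul hb))
    (word_ne_zero hq_diag hq_inv _)

/-- Left invertible elements are scalars. -/
theorem exists_eq_algebraMap_of_mul_eq_one (hq_diag : ∀ i, q i i = 1)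
    (hq_inv : ∀ i j, q i j * q j i = 1) {a b : QuantumAffineSpace q} (h : a * b = 1) :
    ∃ c : k, b = algebraMap k _ c := by
  -- At a uniquely attained sum `d + e` the component of `a * b = 1` is a nonzero product, so `d + e
  -- = 0`, and in `ℕ^n` both summands vanish.
  have hdeg : ∀ d ∈ (decompose q a).coeff.support, ∀ e ∈ (decompose q b).coeff.support,
      UniqueAdd (decompose q a).coeff.support (decompose q b).coeff.support d e →
        d = 0 ∧ e = 0 := by
    intro d hd e he hu
    have h1 := AddMonoidAlgebra.coeff_mul_add_of_uniqueAdd hu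
    have h2 := coeff_decompose_mul_ne_zero hq_diag hq_inv (Finsupp.mem_support_iff.1 hd)
      (Finsupp.mem_support_iff.1 he)
    rw [← h1, ← map_mul, h, map_one, AddMonoidAlgebra.one_def] at h2
    by_contra h3
    refine h2 ?_
    rw [AddMonoidAlgebra.coeff_single, Finsupp.single_apply, if_neg]
    exact fun h4 => h3 (add_eq_zero.1 h4.symm)
  have hne : ∀ c : QuantumAffineSpace q, c ≠ 0 → (decompose q c).coeff.support.Nonempty := by
    intro c hc
    rw [Finsupp.support_nonempty_iff]
    intro h0
    exact hc (by rw [← sum_coeff_decompose c, h0, Finsupp.sum_zero_index])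
  have ha := hne a (left_ne_zero_of_mul_eq_one h)
  have hb := hne b (right_ne_zero_of_mul_eq_one h)
  have hsupp : (decompose q b).coeff.support ⊆ {0} := by
    -- With more than one pair of degrees there would be two distinct uniquely attained sums, both
    -- forced to come from `(0, 0)`. Hence both supports are singletons, and the remaining unique
    -- pair is `(0, 0)`.
    by_cases hcard : 1 < (decompose q a).coeff.support.card * (decompose q b).coeff.support.card
    · obtain ⟨p, hp, p', hp', hpp, hu, hu'⟩ := TwoUniqueSums.uniqueAdd_of_one_lt_card hcard
      rw [Finset.mem_product] at hp hp'
      obtain ⟨h1, h2⟩ := hdeg _ hp.1 _ hp.2 hu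
      obtain ⟨h3, h4⟩ := hdeg _ hp'.1 _ hp'.2 hu'
      exact absurd (Prod.ext (h1.trans h3.symm) (h2.trans h4.symm)) hpp
    · obtain ⟨d, hd, e, he, hu⟩ := UniqueSums.uniqueAdd_of_nonempty ha hb
      obtain ⟨-, rfl⟩ := hdeg d hd e he hu
      have hle : (decompose q b).coeff.support.card ≤ 1 :=
        (Nat.le_mul_of_pos_left _ ha.card_pos).trans (not_lt.1 hcard)
      intro f hf
      rw [Finset.mem_singleton]
      exact Finset.card_le_one.1 hle f hf 0 he
  obtain ⟨c, hc⟩ := exists_coeff_decompose_eq b []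
  refine ⟨c, ?_⟩
  rw [← sum_coeff_decompose b, Finsupp.sum_of_support_subset _ hsupp _ (fun _ _ => rfl),
    Finset.sum_singleton, Algebra.algebraMap_eq_smul_one]
  simpa [word, wordDegree] using hc

end QuantumAffineSpace

end Units

/-! ### Identification and uniqueness of the Nakayama automorphism. -/

section NakayamaAutomorphism

open MulOpposite CategoryTheory Abelian EnvelopingAlgebra

namespace QuantumAffineSpace

/-- The image `u` of `1` satisfies `ν(b) u = u ν'(b)`, and surjectivity gives a left inverse of `u`.
Since `u` is then a scalar, it cancels. -/
theorem eq_of_twistedBimodule_equiv {k : Type v} [Field k] {n : ℕ}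
    {q : Matrix (Fin n) (Fin n) k} (hq_diag : ∀ i, q i i = 1)
    (hq_inv : ∀ i j, q i j * q j i = 1) {ν ν' : QuantumAffineSpace q ≃ₐ[k] QuantumAffineSpace q}
    (e : TwistedBimodule k ν ≃ₗ[EnvelopingAlgebra k (QuantumAffineSpace q)]
      TwistedBimodule k ν') : ν = ν' := by
  obtain ⟨u, hu⟩ := (TwistedBimodule.of ν').surjective (e (TwistedBimodule.of ν 1))
  have h1 : ∀ a b, e (TwistedBimodule.of ν (a * ν b)) = TwistedBimodule.of ν' (a * u * ν' b) := by
    intro a b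
    rw [← TwistedBimodule.tmul_op_smul, hu, ← map_smul, TwistedBimodule.tmul_op_smul, mul_one]
  have h2 : ∀ b, ν b * u = u * ν' b := by
    intro b
    apply (TwistedBimodule.of ν').injective
    have h3 := h1 (ν b) 1
    have h4 := h1 1 b
    rw [map_one, map_one, mul_one, mul_one] at h3
    rw [one_mul, one_mul] at h4
    exact h3.symm.trans h4
  obtain ⟨m, hm⟩ := e.surjective (TwistedBimodule.of ν' 1)
  obtain ⟨v, rfl⟩ := (TwistedBimodule.of ν).surjective m
  have hv : v * u = 1 := by
    apply (TwistedBimodule.of ν').injective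
    have h3 := h1 v 1
    rw [map_one, map_one, mul_one, mul_one] at h3
    exact h3.symm.trans hm
  obtain ⟨c, rfl⟩ := exists_eq_algebraMap_of_mul_eq_one hq_diag hq_inv hv
  refine AlgEquiv.ext fun b => ?_
  have h3 := congrArg (v * ·) (h2 b)
  simp only [← Algebra.commutes c (ν b), ← mul_assoc, hv, one_mul] at h3
  exact h3

variable {k : Type u} [Field k] {n : ℕ} {q : Matrix (Fin n) (Fin n) k}

/-- The diagonal automorphism `x_i ↦ c_i x_i`. -/
noncomputable def scale (c : Fin n → kˣ) : QuantumAffineSpace q ≃ₐ[k] QuantumAffineSpace q :=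
  have h : ∀ (c : Fin n → k) (i j : Fin n),
      (c j • x q j) * (c i • x q i) = q i j • ((c i • x q i) * (c j • x q j)) := by
    intro c i j
    rw [smul_mul_smul_comm, smul_mul_smul_comm, x_mul_x i j, smul_comm, mul_comm (c i)]
  AlgEquiv.ofAlgHom (lift (fun i => (c i : k) • x q i) (h _))
    (lift (fun i => ((c i)⁻¹ : kˣ).val • x q i) (h _))
    (algHom_ext fun i => by simp [smul_smul])
    (algHom_ext fun i => by simp [smul_smul])

theorem scale_x (c : Fin n → kˣ) (i : Fin n) : scale c (x q i) = (c i : k) • x q i := by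
  simp [scale]

/-- Diagonally twisted bimodules are cyclic. -/
noncomputable def twistedBimoduleEquiv (ν : QuantumAffineSpace q ≃ₐ[k] QuantumAffineSpace q)
    (c κ : Fin n → k) (hν : ∀ i, ν (x q i) = c i • x q i) (hc : ∀ i, κ i * c i = 1) :
    (EnvelopingAlgebra k (QuantumAffineSpace q) ⧸ skewIdeal q Finset.univ κ)
      ≃ₗ[EnvelopingAlgebra k (QuantumAffineSpace q)] TwistedBimodule k ν :=
  (Submodule.quotEquivOfEq _ _ (by
    ext r
    exact (smul_of_one_eq_zero_iff ν c κ hν hc r).symm)).trans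
    ((LinearMap.toSpanSingleton (EnvelopingAlgebra k (QuantumAffineSpace q))
      (TwistedBimodule k ν) (TwistedBimodule.of ν 1)).quotKerEquivOfSurjective
        (exists_smul_of_one ν))

variable (q) in
theorem isHomologicallySmooth (hq_diag : ∀ i, q i i = 1) (hq_inv : ∀ i j, q i j * q j i = 1) :
    IsHomologicallySmooth k (QuantumAffineSpace q) := by
  have h := hasFiniteProjectiveResolution_skewQuotient hq_diag hq_inv Finset.univ (fun _ => 1)
  obtain ⟨P, hP, hP0⟩ := (h.of_equiv (twistedBimoduleEquiv AlgEquiv.refl 1 (fun _ => 1)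
    (fun i => (one_smul _ _).symm) (fun i => mul_one _))).exists_projectiveResolution
  exact ⟨P, hP, _, hP0⟩

theorem isTwistedCalabiYau (hq_diag : ∀ i, q i i = 1) (hq_inv : ∀ i j, q i j * q j i = 1)
    (ν : QuantumAffineSpace q ≃ₐ[k] QuantumAffineSpace q)
    (hν : ∀ i, ν (x q i) = (∏ j, q j i) • x q i) : IsTwistedCalabiYau k ν n := by
  obtain ⟨θ, hθ⟩ : ∃ θ, IsKoszulClass hq_inv Finset.univ n θ := by
    have h := exists_isKoszulClass hq_diag hq_inv Finset.univ
    rwa [Finset.card_univ, Fintype.card_fin] at h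
  let e : ModuleCat.of (EnvelopingAlgebra k (QuantumAffineSpace q))
      (RegularBimodule k (QuantumAffineSpace q)) ≅ skewQuotient q Finset.univ fun _ => 1 :=
    (twistedBimoduleEquiv (q := q) AlgEquiv.refl 1 (fun _ => 1)
      (fun i => (one_smul _ _).symm) (fun i => mul_one _)).symm.toModuleIso
  have h := (hθ.isCyclicExt _ (fun _ => one_ne_zero)).of_iso e
  refine ⟨isHomologicallySmooth q hq_diag hq_inv,
    fun i hi => ⟨fun α β => (h.eq_zero i hi α).trans (h.eq_zero i hi β).symm⟩, ⟨?_⟩⟩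
  let φ : EnvelopingAlgebra k (QuantumAffineSpace q) →ₗ[EnvelopingAlgebra k (QuantumAffineSpace q)]
      BimoduleExt k (QuantumAffineSpace q) n :=
    LinearMap.toSpanSingleton _ _ ((Ext.mk₀ e.hom).comp (θ fun _ => 1) (zero_add n))
  have hφ : Function.Surjective φ := fun α => by
    obtain ⟨r, hr⟩ := h.exists_eq α
    exact ⟨r, hr.symm⟩
  have hker : LinearMap.ker φ = skewIdeal q Finset.univ (dualParam q Finset.univ fun _ => 1) :=
    Submodule.ext fun r => h.innerExt_eq_zero_iff r
  refine ((φ.quotKerEquivOfSurjective hφ).symm.trans (Submodule.quotEquivOfEq _ _ hker)).trans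
    (twistedBimoduleEquiv ν _ _ hν fun i => ?_)
  -- The annihilator parameter `∏_j q_{ij}` and the eigenvalue `∏_j q_{ji}` must be mutually
  -- inverse, which holds factor by factor.
  rw [dualParam, div_one, ← Finset.prod_mul_distrib]
  exact Finset.prod_eq_one fun j _ => hq_inv i j

end QuantumAffineSpace

end NakayamaAutomorphism

theorem mainTheorem5 {k : Type u} [Field k] {n : ℕ} (hn : 1 ≤ n)
    (q : Matrix (Fin n) (Fin n) k) (hq_diag : ∀ i, q i i = 1)
    (hq_inv : ∀ i j, q i j * q j i = 1) :
    ∃ ν : QuantumAffineSpace q ≃ₐ[k] QuantumAffineSpace q,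
      IsTwistedCalabiYau k ν n ∧
      (∀ i, ν (QuantumAffineSpace.x q i) = (∏ j, q j i) • QuantumAffineSpace.x q i) ∧
      ∀ ν' : QuantumAffineSpace q ≃ₐ[k] QuantumAffineSpace q,
        IsTwistedCalabiYau k ν' n → ν' = ν := by
  let c : Fin n → kˣ := fun i => ∏ j, Units.mkOfMulEqOne (q j i) (q i j) (hq_inv j i)
  have hc : ∀ i, QuantumAffineSpace.scale c (QuantumAffineSpace.x q i) =
      (∏ j, q j i) • QuantumAffineSpace.x q i := by
    intro i
    rw [QuantumAffineSpace.scale_x]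
    simp [c]
  have hCY := QuantumAffineSpace.isTwistedCalabiYau hq_diag hq_inv _ hc
  refine ⟨QuantumAffineSpace.scale c, hCY, hc, fun ν' hν' => ?_⟩
  obtain ⟨e⟩ := hCY.ext_iso
  obtain ⟨e'⟩ := hν'.ext_iso
  exact QuantumAffineSpace.eq_of_twistedBimodule_equiv hq_diag hq_inv (e'.symm.trans e)
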